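/- **Setting.** There are $m\ge 1$ asynchronous processes with identifiers $1,\dots,m$ and $n\ge m$ jobs $1,\dots,n$; processes communicate through atomic read/write cells. Algorithm $KK_\beta$ (termination parameter $\beta\in\mathbb N$, $\beta\ge m$) uses shared cells $next_q$ ($1\le q\le m$) and $done_{q,i}$ ($1\le q\le m$, $1\le i\le n$), all initially $0$. Process $p$ keeps sets $FREE_p$ (initially $\{1,\dots,n\}$), $DONE_p$ and $TRY_p$ (initially empty), and pointers $pos_p(q)$, initially $1$. It repeats the following, every read, write and local computation being a separate atomic step. 1. (compNext) If $|FREE_p\setminus TRY_p|<\beta$, terminate. Otherwise let $t=(|FREE_p|-(m-1))/m$, let $x$ be the element of $FREE_p\setminus TRY_p$ whose rank in ascending order is $\lfloor (p-1)t\rfloor+1$ if $t\ge 1$ and $p$ if $t<1$, and reset $TRY_p=\emptyset$. 2. (setNext) Write $next_p:=x$. 3. (gatherTry) For $q=1,\dots,m$, $q\ne p$, read $next_q$ and add the value to $TRY_p$. 4. (gatherDone) For $q=1,\dots,m$, $q\neq p$: as long as $pos_p(q)\le n$ and the value read from $done_{q,pos_p(q)}$ is positive, add this value to $DONE_p$,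 remove it from $FREE_p$ and increase $pos_p(q)$ by one. 5. (check) If $x\in TRY_p\cup DONE_p$, go back to 1. Otherwise perform job $x$ (action $do_{p,x}$), then write $done_{p,pos_p(p)}:=x$, add $x$ to $DONE_p$, remove it from $FREE_p$, increase $pos_p(p)$ by one, and go back to 1. An adversary chooses the interleaving and may crash a process at any time by an action $stop_p$, after which $p$ takes no action. A finite execution is fair if no action other than a crash is enabled in its last state; an infinite one is fair if every action other than a crash is performed infinitely often or is disabled in infinitely many states. The effectiveness $E(n,m,f)$ is the minimum, over all fair executions with at most $f$ crashes, of the number of distinct jobs performed. **Theorem.** Let $\beta\ge m$, $n\ge m$ and $0\le f\le m-1$. (i) Every fair execution of $KK_\beta$ with at most $f$ crashes is finite, and at least $n-(\beta+m-2)$ jobs are performed in it. (ii) If moreover $n\ge \beta+m-1$ and $m(\beta-m+f)<(f+1)(n-m+1)$, then $$E(n,m,f)=n-(\beta+m-2).$$ (Given $n\ge\beta+m-1$, the second inequality holds automatically if $f=m-1$, or if $\beta=m$, or if $n\ge m(\beta-m+1)$.) (iii) In particular, if $\beta=m$ and $n\ge 2m-1$, then $E(n,m,f)=n-(2m-2)=n-2m+2$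 for every $f\le m-1$. -/

import Mathlib

namespace KK

/-! ### Automata, executions, fairness -/

/-- An input/output automaton: start states, transitions, and which actions are locally
controlled (output or internal; the remaining ones are inputs). -/
structure Automaton (σ α : Type) where
  start : Set σ
  trans : σ → α → σ → Prop
  isLocal : α → Prop

variable {σ α : Type}

/-- An action is enabled in a state if some transition with this action leaves the state. -/
def Automaton.Enabled (A : Automaton σ α) (s : σ) (a : α) : Prop :=
  ∃ s', A.trans s a s'

/-- An execution `s₀, π₁, s₁, π₂, s₂, …` with `len` actions, `len ∈ ℕ ∪ {∞}`. Here `state k` is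
`sₖ` and `act k` is `πₖ₊₁`; only the states `state k` with `k ≤ len` and the actions `act k` with
`k < len` belong to the execution. -/
structure Execution (A : Automaton σ α) where
  len : ℕ∞
  state : ℕ → σ
  act : ℕ → α
  start_mem : state 0 ∈ A.start
  step : ∀ k : ℕ, (k : ℕ∞) < len → A.trans (state k) (act k) (state (k + 1))

/-- The action `a` occurs in the execution. -/
def Execution.Occurs {A : Automaton σ α} (e : Execution A) (a : α) : Prop :=
  ∃ k : ℕ, (k : ℕ∞) < e.len ∧ e.act k = a

/-- A finite execution is fair if no locally controlled action is enabled in its last state; an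
infinite one is fair if every locally controlled action is performed infinitely many times or is
disabled in infinitely many states. -/
def Execution.Fair {A : Automaton σ α} (e : Execution A) : Prop :=
  (∀ r : ℕ, e.len = r → ∀ a, A.isLocal a → ¬ A.Enabled (e.state r) a) ∧
  (e.len = ⊤ → ∀ a, A.isLocal a →
    {k : ℕ | e.act k = a}.Infinite ∨ {k : ℕ | ¬ A.Enabled (e.state k) a}.Infinite)

/-! ### The algorithm

There are `m` processes and `n` jobs. Process number `p ∈ {1, …, m}` is the element `p - 1` of
`Fin m`; jobs are the numbers `1, …, n`, and `0` is the initial value of every shared cell. -/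

/-- The status of a process; `perform` and `record` are the statuses "do" and "done". -/
inductive Status
  | compNext | setNext | gatherTry | gatherDone | check | perform | record | finished | stopped
  deriving DecidableEq

/-- The internal variables of a process. (The temporary variable of the algorithm is always
assigned before it is used within the same action, so it is not part of the state.) -/
structure LocalState (m : ℕ) where
  status : Status
  free : Finset ℕ
  done : Finset ℕ
  try_ : Finset ℕ
  /-- `pos q` points into row `q` of the shared matrix; columns are numbered from 1. -/
  pos : Fin m → ℕ
  /-- The job that the process is attempting to perform. -/
  nxt : ℕ
  /-- Loop index over processes. -/
  q : Fin m

/-- A global state: the shared array `next`, the shared matrix `done` (columns `1, …, n` are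
used), and the local state of every process. -/
structure State (m : ℕ) where
  next : Fin m → ℕ
  done : Fin m → ℕ → ℕ
  loc : Fin m → LocalState m

/-- The actions. `crash` is the only input action; `perform p j` is the output action
"process `p` performs job `j`"; the other actions are internal. -/
inductive Action (m : ℕ)
  | crash (p : Fin m)
  | compNext (p : Fin m)
  | setNext (p : Fin m)
  | gatherTry (p : Fin m)
  | gatherDone (p : Fin m)
  | check (p : Fin m)
  | perform (p : Fin m) (j : ℕ)
  | record (p : Fin m)

/-- The element of rank `i` of `S` in ascending order, ranks being counted from 1. -/
def elementOfRank (S : Finset ℕ) (i : ℕ) : ℕ :=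
  (S.sort (· ≤ ·)).getD (i - 1) 0

/-- The rank computed by process number `p + 1` when its set of free jobs has `k` elements:
with `t = (k - (m - 1)) / m` it is `⌊p * t⌋ + 1` if `t ≥ 1`, and `p + 1` otherwise. -/
def chosenRank (m k p : ℕ) : ℕ :=
  let t : ℚ := ((k : ℚ) - ((m : ℚ) - 1)) / m
  if 1 ≤ t then ⌊(p : ℚ) * t⌋₊ + 1 else p + 1

/-- Advance the loop index; after the last process, reset it and move to status `st`. -/
def LocalState.advance {m : ℕ} (l : LocalState m) (st : Status) : LocalState m :=
  if h : l.q.val + 1 < m then { l with q := ⟨l.q.val + 1, h⟩ }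
  else { l with q := ⟨0, l.q.pos⟩, status := st }

/-- Effect of `compNext` on process `p`, with termination parameter `β`. -/
def LocalState.compNext {m : ℕ} (β : ℕ) (p : Fin m) (l : LocalState m) : LocalState m :=
  if β ≤ (l.free \ l.try_).card then
    { l with
      nxt := elementOfRank (l.free \ l.try_) (chosenRank m l.free.card p.val)
      q := ⟨0, p.pos⟩
      try_ := ∅
      status := .setNext }
  else { l with status := .finished }

/-- Effect of `gatherTry` on process `p`: read `next` at the loop index, then advance. -/
def LocalState.gatherTry {m : ℕ} (n : ℕ) (next : Fin m → ℕ) (p : Fin m) (l : LocalState m) :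
    LocalState m :=
  (if l.q ≠ p ∧ next l.q ≤ n then { l with try_ := insert (next l.q) l.try_ } else l).advance
    .gatherDone

/-- Effect of `gatherDone` on process `p`: read a fresh entry of the row given by the loop index;
if there is none, advance. -/
def LocalState.gatherDone {m : ℕ} (n : ℕ) (done : Fin m → ℕ → ℕ) (p : Fin m)
    (l : LocalState m) : LocalState m :=
  if l.q ≠ p ∧ l.pos l.q ≤ n ∧ 0 < done l.q (l.pos l.q) then
    { l with
      done := insert (done l.q (l.pos l.q)) l.done
      free := l.free.erase (done l.q (l.pos l.q))
      pos := Function.update l.pos l.q (l.pos l.q + 1) }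
  else l.advance .check

/-- Effect of `check`. -/
def LocalState.check {m : ℕ} (l : LocalState m) : LocalState m :=
  if l.nxt ∉ l.try_ ∧ l.nxt ∉ l.done then { l with status := .perform }
  else { l with status := .compNext }

/-- Effect of `record` on the local state of process `p`. -/
def LocalState.record {m : ℕ} (p : Fin m) (l : LocalState m) : LocalState m :=
  { l with
    done := insert l.nxt l.done
    free := l.free.erase l.nxt
    pos := Function.update l.pos p (l.pos p + 1)
    status := .compNext }

/-- Replace the local state of process `p`. -/
def State.setLoc {m : ℕ} (s : State m) (p : Fin m) (l : LocalState m) : State m :=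
  { s with loc := Function.update s.loc p l }

/-- The unique start state. -/
def initState (n m : ℕ) : State m where
  next := fun _ => 0
  done := fun _ _ => 0
  loc := fun p =>
    { status := .compNext
      free := Finset.Icc 1 n
      done := ∅
      try_ := ∅
      pos := fun _ => 1
      nxt := 0
      q := ⟨0, p.pos⟩ }

/-- The transitions. A crashed process takes no further action, in particular it does not crash
again; a process may crash at any other time. -/
def trans (n m β : ℕ) (s : State m) : Action m → State m → Prop
  | .crash p, s' => (s.loc p).status ≠ .stopped ∧
      s' = s.setLoc p { s.loc p with status := .stopped }
  | .compNext p, s' => (s.loc p).status = .compNext ∧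
      s' = s.setLoc p ((s.loc p).compNext β p)
  | .setNext p, s' => (s.loc p).status = .setNext ∧
      s' = { s.setLoc p { s.loc p with status := .gatherTry } with
        next := Function.update s.next p (s.loc p).nxt }
  | .gatherTry p, s' => (s.loc p).status = .gatherTry ∧
      s' = s.setLoc p ((s.loc p).gatherTry n s.next p)
  | .gatherDone p, s' => (s.loc p).status = .gatherDone ∧
      s' = s.setLoc p ((s.loc p).gatherDone n s.done p)
  | .check p, s' => (s.loc p).status = .check ∧
      s' = s.setLoc p (s.loc p).check
  | .perform p j, s' => (s.loc p).status = .perform ∧ (s.loc p).nxt = j ∧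
      s' = s.setLoc p { s.loc p with status := .record }
  | .record p, s' => (s.loc p).status = .record ∧
      s' = { s.setLoc p ((s.loc p).record p) with
        done := Function.update s.done p
          (Function.update (s.done p) ((s.loc p).pos p) (s.loc p).nxt) }

/-- The algorithm for `n` jobs and `m` processes with termination parameter `β`. -/
def algorithm (n m β : ℕ) : Automaton (State m) (Action m) where
  start := {initState n m}
  trans := trans n m β
  isLocal := fun a => ∀ p, a ≠ .crash p

/-! ### Effectiveness -/

variable {m : ℕ} {A : Automaton (State m) (Action m)}

/-- The set of processes that crash in the execution. -/
def crashed (e : Execution A) : Set (Fin m) :=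
  {p | e.Occurs (.crash p)}

/-- The number of jobs among `1, …, n` that are performed in the execution. -/
noncomputable def numDone (n : ℕ) (e : Execution A) : ℕ :=
  {j : ℕ | j ∈ Finset.Icc 1 n ∧ ∃ p, e.Occurs (.perform p j)}.ncard

/-- The fair executions with at most `f` crashes. -/
def fairExecs (A : Automaton (State m) (Action m)) (f : ℕ) : Set (Execution A) :=
  {e | e.Fair ∧ (crashed e).ncard ≤ f}

/-- `A` has effectiveness `v` for `n` jobs and `f` crashes: `v` is the minimum, over all fair
executions with at most `f` crashes, of the number of performed jobs. -/
def HasEffectiveness (A : Automaton (State m) (Action m)) (n f v : ℕ) : Prop :=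
  IsLeast (numDone n '' fairExecs A f) v

end KK

namespace KK

variable {n m β : ℕ}

/-! Termination. In an infinite run, let L be the set of processes that act infinitely often.
Pointers are monotone and at most n + 1, so from some time on only members of L act and none of them
performs, records or learns of a job (`QuietRun`). Each member of L has then read the whole matrix,
so all share one set G of free jobs, and eventually all know the set S of announcements left behind
by the processes outside L. Put F = G \ S. The rank used by a process increases strictly with its
index. Let p be least in L, with rank r. The other members of L choose by larger ranks in subsets of
F, so eventually none of them announces one of the first r elements of F. Hence p settles on the
r-th element of F and its check must succeed, which is impossible in a quiet run (`QuietRun.elim`,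
`no_infinite_run`).

Lower bound. As f < m, some process survives, and in the last state of a fair execution it has
terminated. Its TRY has at most m - 1 elements and FREE \ TRY at most β - 1, so FREE has at most β +
m - 2. All other jobs are in DONE, hence were performed (`le_numDone`).

Upper bound. Process 1, called w, always uses rank 1 and so works upwards through the jobs. Every
other process first selects a job `x q`; the f processes of largest index announce theirs and crash.
When w has announced the job of a live q, q announces it too, reads `next w`, and pauses: q can no
longer perform the job, and w gives it up as well. The state after each job is described by `Stage`;
the moves are `Stage.perform`, `Stage.collide` and `Stage.skip`. When w is left with β - 1
candidates it terminates, and so do the paused processes once resumed. The m - 1 jobs `x q` and the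
β - 1 candidates stay undone. The schedule works only if w meets the jobs of all live processes
before it stops; the second inequality ensures this (`chosenRank_add_le`). -/

/-- The process that takes a given action. -/
def Action.actor : Action m → Fin m
  | .crash p => p
  | .compNext p => p
  | .setNext p => p
  | .gatherTry p => p
  | .gatherDone p => p
  | .check p => p
  | .perform p _ => p
  | .record p => p

/-- Every shared cell has a single writer, so the component of any other process survives a step
untouched. -/
theorem trans_of_actor_ne {s s' : State m} {a : Action m} (h : trans n m β s a s') {q : Fin m}
    (hq : q ≠ a.actor) :
    s'.loc q = s.loc q ∧ s'.next q = s.next q ∧ s'.done q = s.done q := by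
  cases a <;> simp only [trans, Action.actor] at h hq
  case perform p j => obtain ⟨_, _, rfl⟩ := h; simp [State.setLoc, hq]
  all_goals obtain ⟨_, rfl⟩ := h; simp [State.setLoc, hq]

/-! ### Ranks -/

/-- The number of elements of `S` below `x`. -/
def below (S : Finset ℕ) (x : ℕ) : ℕ := (S.filter (· < x)).card

theorem below_mono {S T : Finset ℕ} (h : S ⊆ T) (x : ℕ) : below S x ≤ below T x :=
  Finset.card_le_card (Finset.filter_subset_filter _ h)

theorem below_lt_of_lt {S : Finset ℕ} {x y : ℕ} (hx : x ∈ S) (h : x < y) :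
    below S x < below S y := by
  apply Finset.card_lt_card
  rw [Finset.ssubset_iff_of_subset]
  · exact ⟨x, by simp [hx, h], by simp⟩
  · intro z hz
    simp only [Finset.mem_filter] at hz ⊢
    exact ⟨hz.1, hz.2.trans h⟩

theorem below_injOn {S : Finset ℕ} {x y : ℕ} (hx : x ∈ S) (hy : y ∈ S)
    (h : below S x = below S y) : x = y := by
  rcases lt_trichotomy x y with hl | he | hl
  · exact absurd h (below_lt_of_lt hx hl).ne
  · exact he
  · exact absurd h (below_lt_of_lt hy hl).ne'

theorem elementOfRank_mem {S : Finset ℕ} {i : ℕ} (hi : 1 ≤ i) (hS : i ≤ S.card) :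
    elementOfRank S i ∈ S := by
  have h : i - 1 < (S.sort (· ≤ ·)).length := by rw [Finset.length_sort]; omega
  rw [elementOfRank, List.getD_eq_getElem _ _ h, ← Finset.mem_sort (· ≤ ·)]
  exact List.getElem_mem h

theorem below_elementOfRank {S : Finset ℕ} {i : ℕ} (hi : 1 ≤ i) (hS : i ≤ S.card) :
    below S (elementOfRank S i) = i - 1 := by
  have h : i - 1 < S.card := by omega
  have h' : i - 1 < (S.sort (· ≤ ·)).length := by rwa [Finset.length_sort]
  have he : elementOfRank S i = S.orderEmbOfFin rfl ⟨i - 1, h⟩ := by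
    rw [elementOfRank, List.getD_eq_getElem _ _ h', Finset.orderEmbOfFin_apply]
    rfl
  have hf : S.filter (· < elementOfRank S i) =
      (Finset.univ.filter (· < (⟨i - 1, h⟩ : Fin S.card))).map
        (S.orderEmbOfFin rfl).toEmbedding := by
    ext z
    simp only [Finset.mem_filter, Finset.mem_map, Finset.mem_univ, true_and]
    constructor
    · rintro ⟨hz, hlt⟩
      have : z ∈ Set.range (S.orderEmbOfFin rfl) := by simpa using hz
      obtain ⟨k, rfl⟩ := this
      exact ⟨k, by rw [he] at hlt; simpa using hlt, rfl⟩
    · rintro ⟨k, hk, rfl⟩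
      refine ⟨Finset.orderEmbOfFin_mem _ _ _, ?_⟩
      rw [he]
      simpa using hk
  have hIio : (Finset.univ.filter (· < (⟨i - 1, h⟩ : Fin S.card))) = Finset.Iio ⟨i - 1, h⟩ := by
    ext; simp
  rw [below, hf, Finset.card_map, hIio, Fin.card_Iio]

/-- Counting smaller elements separates the members of `S`. In this form ranks taken in different
sets become comparable through `below`. -/
theorem elementOfRank_eq {S : Finset ℕ} {i x : ℕ} (hi : 1 ≤ i) (hx : x ∈ S)
    (h : below S x = i - 1) : elementOfRank S i = x := by
  have hS : i ≤ S.card := by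
    have : below S x < S.card := by
      apply Finset.card_lt_card
      rw [Finset.ssubset_iff_of_subset (Finset.filter_subset _ _)]
      exact ⟨x, hx, by simp⟩
    omega
  exact below_injOn (elementOfRank_mem hi hS) hx (by rw [below_elementOfRank hi hS, h])

theorem one_le_chosenRank (m k p : ℕ) : 1 ≤ chosenRank m k p := by
  simp only [chosenRank]
  split <;> omega

theorem chosenRank_zero (m k : ℕ) : chosenRank m k 0 = 1 := by
  simp [chosenRank]

/-- When t ≥ 1, adding t to the product raises its floor by at least one. This asymmetry between
processes is what breaks ties in the termination proof. -/
theorem chosenRank_strictMono (m k : ℕ) : StrictMono (chosenRank m k) := by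
  apply strictMono_nat_of_lt_succ
  intro p
  simp only [chosenRank]
  split_ifs with h
  · set t : ℚ := ((k : ℚ) - ((m : ℚ) - 1)) / m
    have h1 : ⌊(p : ℚ) * t⌋₊ + 1 = ⌊(p : ℚ) * t + 1⌋₊ :=
      (Nat.floor_add_one (by positivity)).symm
    have h2 : ⌊(p : ℚ) * t + 1⌋₊ ≤ ⌊((p + 1 : ℕ) : ℚ) * t⌋₊ := by
      apply Nat.floor_le_floor
      push_cast
      linarith
    omega
  · omega

/-- The bound on `k` says t * m ≤ b, and for p ≤ m - 1 and t ≥ 1 one has p * t + 1 ≤ m * t - t + 1 ≤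
m * t. -/
theorem chosenRank_le {m k p b : ℕ} (hp : p < m) (hb : m ≤ b) (hk : k ≤ b + (m - 1)) :
    chosenRank m k p ≤ b := by
  have hm : (0 : ℚ) < m := by exact_mod_cast (Nat.zero_le p).trans_lt hp
  simp only [chosenRank]
  split_ifs with h
  · set t : ℚ := ((k : ℚ) - ((m : ℚ) - 1)) / m with ht
    have h1 : t * m = (k : ℚ) - ((m : ℚ) - 1) := by rw [ht]; field_simp
    have h2 : (k : ℚ) ≤ b + (m - 1) := by
      have : k + 1 ≤ b + m := by omega
      have : ((k + 1 : ℕ) : ℚ) ≤ ((b + m : ℕ) : ℚ) := by exact_mod_cast this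
      push_cast at this; linarith
    have h3 : (p : ℚ) + 1 ≤ m := by exact_mod_cast hp
    have h4 : ⌊(p : ℚ) * t⌋₊ + 1 = ⌊(p : ℚ) * t + 1⌋₊ :=
      (Nat.floor_add_one (by positivity)).symm
    rw [h4]
    have h5 : (p : ℚ) * t + 1 ≤ b := by nlinarith
    exact Nat.floor_le_of_le h5
  · omega

/-! ### Invariants -/

/-- Invariants that concern only the local state of process `p`. -/
structure LocalInv (n β : ℕ) (p : Fin m) (l : LocalState m) : Prop where
  free_eq : l.free = Finset.Icc 1 n \ l.done
  pos_le : l.pos p + l.free.card ≤ n + 1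
  nxt_mem : l.status ∈ ({.setNext, .gatherTry, .gatherDone, .check, .perform, .record} :
    Set Status) → l.nxt ∈ Finset.Icc 1 n
  nxt_free : l.status ∈ ({.perform, .record} : Set Status) → l.nxt ∈ l.free
  try_card : l.try_.card ≤ m - 1
  of_setNext : l.status = .setNext → l.try_ = ∅ ∧ l.q.val = 0
  of_gatherTry : l.status = .gatherTry →
    l.try_.card ≤ (Finset.univ.filter fun j : Fin m => j < l.q ∧ j ≠ p).card
  of_finished : l.status = .finished → (l.free \ l.try_).card < β

/-- TRY has at most m - 1 elements, so FREE exceeds FREE \ TRY by at most m - 1. The rank is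
therefore genuine and the default value in `elementOfRank` is never returned. -/
theorem LocalInv.rank_le {p : Fin m} {l : LocalState m} (hl : LocalInv n β p l) (hβ : m ≤ β)
    (h : β ≤ (l.free \ l.try_).card) :
    chosenRank m l.free.card p ≤ (l.free \ l.try_).card := by
  refine chosenRank_le p.2 (hβ.trans h) ?_
  have := Finset.le_card_sdiff l.try_ l.free
  have := hl.try_card
  omega

theorem LocalInv.compNext {p : Fin m} {l : LocalState m} (hl : LocalInv n β p l) (hβ : m ≤ β) :
    LocalInv n β p (l.compNext β p) := by
  unfold LocalState.compNext
  split_ifs with h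
  · have hr := hl.rank_le hβ h
    have hmem := elementOfRank_mem (one_le_chosenRank _ _ _) hr
    have : elementOfRank (l.free \ l.try_) (chosenRank m l.free.card p) ∈ Finset.Icc 1 n := by
      rw [hl.free_eq] at hmem ⊢
      exact (Finset.mem_sdiff.1 (Finset.mem_sdiff.1 hmem).1).1
    exact ⟨hl.free_eq, hl.pos_le, fun _ => this, by simp, by simp, by simp, by simp, by simp⟩
  · exact ⟨hl.free_eq, hl.pos_le, by simp, by simp, hl.try_card, by simp, by simp,
      fun _ => by simpa using h⟩

theorem LocalInv.setNext {p : Fin m} {l : LocalState m} (hl : LocalInv n β p l)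
    (h : l.status = .setNext) : LocalInv n β p { l with status := .gatherTry } := by
  have := hl.of_setNext h
  exact ⟨hl.free_eq, hl.pos_le, fun _ => hl.nxt_mem (by simp [h]), by simp, hl.try_card, by simp,
    by simp [this.1], by simp⟩

theorem LocalInv.gatherTry {p : Fin m} {l : LocalState m} (hl : LocalInv n β p l)
    (h : l.status = .gatherTry) (next : Fin m → ℕ) :
    LocalInv n β p (l.gatherTry n next p) := by
  have hc := hl.of_gatherTry h
  have hn := hl.nxt_mem (by simp [h])
  unfold LocalState.gatherTry
  set l' := (if l.q ≠ p ∧ next l.q ≤ n then { l with try_ := insert (next l.q) l.try_ } else l)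
    with hl'
  have hq : l'.q = l.q := by rw [hl']; split_ifs <;> rfl
  have hfree : l'.free = l.free := by rw [hl']; split_ifs <;> rfl
  have hdone : l'.done = l.done := by rw [hl']; split_ifs <;> rfl
  have hpos : l'.pos = l.pos := by rw [hl']; split_ifs <;> rfl
  have hnxt : l'.nxt = l.nxt := by rw [hl']; split_ifs <;> rfl
  have hst : l'.status = l.status := by rw [hl']; split_ifs <;> rfl
  -- One read adds at most one job, and none when the loop index is `p` itself; so TRY is bounded by
  -- the number of other processes visited.
  have hcard : l'.try_.card ≤ (Finset.univ.filter fun j : Fin m => j ≤ l.q ∧ j ≠ p).card := by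
    have hsub : (Finset.univ.filter fun j : Fin m => j < l.q ∧ j ≠ p) ⊆
        Finset.univ.filter fun j : Fin m => j ≤ l.q ∧ j ≠ p := by
      intro j; simp only [Finset.mem_filter]; exact fun h => ⟨h.1, h.2.1.le, h.2.2⟩
    rw [hl']
    split_ifs with hif
    · refine (Finset.card_insert_le _ _).trans ((Nat.succ_le_succ hc).trans ?_)
      apply Finset.card_lt_card
      rw [Finset.ssubset_iff_of_subset hsub]
      exact ⟨l.q, by simp [hif.1], by simp⟩
    · exact hc.trans (Finset.card_le_card hsub)
  have hcard' : l'.try_.card ≤ m - 1 := by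
    refine hcard.trans ?_
    have h : (Finset.univ.filter fun j : Fin m => j ≤ l.q ∧ j ≠ p) ⊆ Finset.univ.erase p := by
      intro j hj
      simpa using (Finset.mem_filter.1 hj).2.2
    simpa [Finset.card_erase_of_mem] using Finset.card_le_card h
  unfold LocalState.advance
  split_ifs with hlt
  · refine ⟨by simp [hfree, hdone, hl.free_eq], by simpa [hpos, hfree] using hl.pos_le,
      fun _ => by simpa [hnxt] using hn, by simp [hst, h], hcard', by simp [hst, h],
      fun _ => hcard.trans (Finset.card_le_card ?_), by simp [hst, h]⟩
    intro j
    simp only [Finset.mem_filter, Fin.le_def, Fin.lt_def, hq]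
    exact fun h => ⟨h.1, by omega, h.2.2⟩
  · exact ⟨by simp [hfree, hdone, hl.free_eq], by simpa [hpos, hfree] using hl.pos_le,
      fun _ => by simpa [hnxt] using hn, by simp, hcard', by simp, by simp, by simp⟩

theorem LocalInv.gatherDone {p : Fin m} {l : LocalState m} (hl : LocalInv n β p l)
    (h : l.status = .gatherDone) (done : Fin m → ℕ → ℕ) :
    LocalInv n β p (l.gatherDone n done p) := by
  have hn := hl.nxt_mem (by simp [h])
  unfold LocalState.gatherDone
  split_ifs with hif
  · refine ⟨?_, ?_, fun _ => hn, by simp [h], hl.try_card, by simp [h], by simp [h], by simp [h]⟩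
    · ext z
      simp only [hl.free_eq, Finset.mem_erase, Finset.mem_sdiff, Finset.mem_insert]
      tauto
    · have := hl.pos_le
      have := Finset.card_erase_le (s := l.free) (a := done l.q (l.pos l.q))
      simp only [Function.update_of_ne (Ne.symm hif.1)]
      omega
  · unfold LocalState.advance
    split_ifs with hlt
    · exact ⟨hl.free_eq, hl.pos_le, fun _ => hn, by simp [h], hl.try_card, by simp [h],
        by simp [h], by simp [h]⟩
    · exact ⟨hl.free_eq, hl.pos_le, fun _ => hn, by simp, hl.try_card, by simp,
        by simp, by simp⟩

theorem LocalInv.check {p : Fin m} {l : LocalState m} (hl : LocalInv n β p l)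
    (h : l.status = .check) : LocalInv n β p l.check := by
  have hn := hl.nxt_mem (by simp [h])
  unfold LocalState.check
  split_ifs with hif
  · exact ⟨hl.free_eq, hl.pos_le, fun _ => hn,
      fun _ => by simpa [hl.free_eq, hif.2] using hn, hl.try_card, by simp, by simp, by simp⟩
  · exact ⟨hl.free_eq, hl.pos_le, by simp, by simp, hl.try_card, by simp, by simp, by simp⟩

theorem LocalInv.perform {p : Fin m} {l : LocalState m} (hl : LocalInv n β p l)
    (h : l.status = .perform) : LocalInv n β p { l with status := .record } :=
  ⟨hl.free_eq, hl.pos_le, fun _ => hl.nxt_mem (by simp [h]),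
    fun _ => hl.nxt_free (by simp [h]), hl.try_card, by simp, by simp, by simp⟩

/-- The own pointer grows by one while one job leaves FREE, so `pos_le` is kept; this needs the
recorded job to be still free. Consequently rows never outgrow column n, and the guard on the
pointer in `gatherDone` hides no entry. -/
theorem LocalInv.record {p : Fin m} {l : LocalState m} (hl : LocalInv n β p l)
    (h : l.status = .record) : LocalInv n β p (l.record p) := by
  have hf := hl.nxt_free (by simp [h])
  refine ⟨?_, ?_, by simp [LocalState.record], by simp [LocalState.record], hl.try_card,
    by simp [LocalState.record], by simp [LocalState.record], by simp [LocalState.record]⟩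
  · ext z
    simp only [LocalState.record, hl.free_eq, Finset.mem_erase, Finset.mem_sdiff,
      Finset.mem_insert]
    tauto
  · have := hl.pos_le
    have := Finset.card_erase_add_one hf
    simp only [LocalState.record, Function.update_self]
    omega

theorem LocalInv.crash {p : Fin m} {l : LocalState m} (hl : LocalInv n β p l) :
    LocalInv n β p { l with status := .stopped } :=
  ⟨hl.free_eq, hl.pos_le, by simp, by simp, hl.try_card, by simp, by simp, by simp⟩

/-- The invariants of reachable states. -/
structure Inv (n β : ℕ) (s : State m) : Prop where
  loc : ∀ p, LocalInv n β p (s.loc p)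
  next_le : ∀ p, s.next p ≤ n
  done_pos : ∀ q i, 0 < s.done q i ↔ 1 ≤ i ∧ i < (s.loc q).pos q
  one_le_pos : ∀ p q, 1 ≤ (s.loc p).pos q
  pos_le_pos : ∀ p q, (s.loc p).pos q ≤ (s.loc q).pos q
  mem_done : ∀ p z, z ∈ (s.loc p).done ↔ ∃ q i, 1 ≤ i ∧ i < (s.loc p).pos q ∧ s.done q i = z

/-! ### Preservation of the invariants -/

theorem inv_init : Inv n β (initState n m) := by
  refine ⟨fun p => ⟨by simp [initState], by simp [initState, add_comm], by simp [initState],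
    by simp [initState], by simp [initState], by simp [initState], by simp [initState],
    by simp [initState]⟩, by simp [initState], by simp [initState]; omega,
    by simp [initState], by simp [initState], by simp [initState]⟩

/-- A step that leaves the matrix and all pointers alone keeps the invariants. -/
theorem Inv.of_quiet {s s' : State m} (hs : Inv n β s) (p : Fin m)
    (hne : ∀ q, q ≠ p → s'.loc q = s.loc q) (hl : LocalInv n β p (s'.loc p))
    (hnext : ∀ q, s'.next q ≤ n) (hmat : s'.done = s.done)
    (hpos : (s'.loc p).pos = (s.loc p).pos) (hdone : (s'.loc p).done = (s.loc p).done) :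
    Inv n β s' := by
  have hpos' : ∀ q, (s'.loc q).pos = (s.loc q).pos := by
    intro q
    rcases eq_or_ne q p with rfl | h
    · exact hpos
    · rw [hne q h]
  have hdone' : ∀ q, (s'.loc q).done = (s.loc q).done := by
    intro q
    rcases eq_or_ne q p with rfl | h
    · exact hdone
    · rw [hne q h]
  refine ⟨fun q => ?_, hnext, ?_, ?_, ?_, ?_⟩
  · rcases eq_or_ne q p with rfl | h
    · exact hl
    · rw [hne q h]; exact hs.loc q
  · simpa only [hmat, hpos'] using hs.done_pos
  · simpa only [hpos'] using hs.one_le_pos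
  · simpa only [hpos'] using hs.pos_le_pos
  · simpa only [hmat, hpos', hdone'] using hs.mem_done

theorem LocalState.advance_pos (l : LocalState m) (st : Status) : (l.advance st).pos = l.pos := by
  unfold LocalState.advance; split_ifs <;> rfl

theorem LocalState.advance_done (l : LocalState m) (st : Status) :
    (l.advance st).done = l.done := by
  unfold LocalState.advance; split_ifs <;> rfl

theorem Inv.step {s s' : State m} {a : Action m} (hβ : m ≤ β) (hs : Inv n β s)
    (h : trans n m β s a s') : Inv n β s' := by
  have hne : ∀ q, q ≠ a.actor → s'.loc q = s.loc q := fun q hq => (trans_of_actor_ne h hq).1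
  cases a with
  | crash p =>
    obtain ⟨hst, rfl⟩ := h
    exact hs.of_quiet p hne (by simpa [State.setLoc] using (hs.loc p).crash) hs.next_le rfl
      (by simp [State.setLoc]) (by simp [State.setLoc])
  | compNext p =>
    obtain ⟨hst, rfl⟩ := h
    refine hs.of_quiet p hne (by simpa [State.setLoc] using (hs.loc p).compNext hβ) hs.next_le rfl
      ?_ ?_ <;> simp only [State.setLoc, Function.update_self, LocalState.compNext] <;>
      split_ifs <;> rfl
  | setNext p =>
    obtain ⟨hst, rfl⟩ := h
    refine hs.of_quiet p hne (by simpa [State.setLoc] using (hs.loc p).setNext hst) ?_ rfl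
      (by simp [State.setLoc]) (by simp [State.setLoc])
    intro q
    rcases eq_or_ne q p with rfl | hq
    · simpa using (Finset.mem_Icc.1 ((hs.loc q).nxt_mem (by simp [hst]))).2
    · simpa [hq] using hs.next_le q
  | gatherTry p =>
    obtain ⟨hst, rfl⟩ := h
    refine hs.of_quiet p hne (by simpa [State.setLoc] using (hs.loc p).gatherTry hst _)
      hs.next_le rfl ?_ ?_ <;>
      simp only [State.setLoc, Function.update_self, LocalState.gatherTry,
        LocalState.advance_pos, LocalState.advance_done] <;> split_ifs <;> rfl
  | check p =>
    obtain ⟨hst, rfl⟩ := h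
    refine hs.of_quiet p hne (by simpa [State.setLoc] using (hs.loc p).check hst) hs.next_le rfl
      ?_ ?_ <;> simp only [State.setLoc, Function.update_self, LocalState.check] <;>
      split_ifs <;> rfl
  | perform p j =>
    obtain ⟨hst, _, rfl⟩ := h
    exact hs.of_quiet p hne (by simpa [State.setLoc] using (hs.loc p).perform hst) hs.next_le rfl
      (by simp [State.setLoc]) (by simp [State.setLoc])
  | gatherDone p =>
    obtain ⟨hst, rfl⟩ := h
    have hl := (hs.loc p).gatherDone hst s.done
    by_cases hif : (s.loc p).q ≠ p ∧ (s.loc p).pos (s.loc p).q ≤ n ∧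
        0 < s.done (s.loc p).q ((s.loc p).pos (s.loc p).q)
    · have hlt := ((hs.done_pos _ _).1 hif.2.2).2
      simp only [LocalState.gatherDone, if_pos hif] at hl ⊢
      set j := (s.loc p).q with hj
      -- A reader moves a pointer only in the row of another process, so the pointers of the writers
      -- into their own rows are unchanged.
      have hdiag : ∀ q, ((s.setLoc p
          { s.loc p with
            done := insert (s.done j ((s.loc p).pos j)) (s.loc p).done
            free := (s.loc p).free.erase (s.done j ((s.loc p).pos j))
            pos := Function.update (s.loc p).pos j ((s.loc p).pos j + 1) }).loc q).pos q =
          (s.loc q).pos q := by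
        intro q
        rcases eq_or_ne q p with rfl | hq
        · simp [State.setLoc, hif.1.symm]
        · simp [State.setLoc, hq]
      refine ⟨fun q => ?_, hs.next_le, ?_, ?_, ?_, ?_⟩
      · rcases eq_or_ne q p with rfl | hq
        · simpa [State.setLoc] using hl
        · simpa [State.setLoc, hq] using hs.loc q
      · intro q i
        rw [hdiag]
        exact hs.done_pos q i
      · intro r q
        rcases eq_or_ne r p with rfl | hr
        · rcases eq_or_ne q j with hq | hq
          · simp [State.setLoc, hq]
          · simpa [State.setLoc, hq] using hs.one_le_pos r q
        · simpa [State.setLoc, hr] using hs.one_le_pos r q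
      · intro r q
        rw [hdiag]
        rcases eq_or_ne r p with rfl | hr
        · rcases eq_or_ne q j with hq | hq
          · rw [hq]; simpa [State.setLoc] using hlt
          · simpa [State.setLoc, hq] using hs.pos_le_pos r q
        · simpa [State.setLoc, hr] using hs.pos_le_pos r q
      · intro r z
        rcases eq_or_ne r p with rfl | hr
        · simp only [State.setLoc, Function.update_self, Finset.mem_insert, hs.mem_done]
          constructor
          · rintro (rfl | ⟨q, i, h1, h2, h3⟩)
            · exact ⟨j, (s.loc r).pos j, hs.one_le_pos _ _, by simp, rfl⟩
            · refine ⟨q, i, h1, ?_, h3⟩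
              rcases eq_or_ne q j with hq | hq
              · rw [hq] at h2 ⊢; simp; omega
              · simpa [hq] using h2
          · rintro ⟨q, i, h1, h2, h3⟩
            rcases eq_or_ne q j with hq | hq
            · rw [hq] at h2 h3
              simp only [Function.update_self] at h2
              rcases Nat.lt_succ_iff_lt_or_eq.1 h2 with h4 | h4
              · exact Or.inr ⟨j, i, h1, h4, h3⟩
              · left; rw [← h3, h4]
            · exact Or.inr ⟨q, i, h1, by simpa [hq] using h2, h3⟩
        · simpa [State.setLoc, hr] using hs.mem_done r z
    · refine hs.of_quiet p hne (by simpa [State.setLoc] using hl) hs.next_le rfl ?_ ?_ <;>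
        simp only [State.setLoc, Function.update_self, LocalState.gatherDone, if_neg hif,
          LocalState.advance_pos, LocalState.advance_done]
  | record p =>
    obtain ⟨hst, rfl⟩ := h
    have hl := (hs.loc p).record hst
    have hn := Finset.mem_Icc.1 ((hs.loc p).nxt_mem (by simp [hst]))
    -- The write goes to the writer's own pointer, and no process has a pointer beyond it in that
    -- row; entries already read stay as they were.
    have hold : ∀ r q i, 1 ≤ i → i < (s.loc r).pos q →
        Function.update s.done p (Function.update (s.done p) ((s.loc p).pos p) (s.loc p).nxt) q i
          = s.done q i := by
      intro r q i _ hi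
      rcases eq_or_ne q p with rfl | hq
      · have : i ≠ (s.loc q).pos q := (hi.trans_le (hs.pos_le_pos r q)).ne
        simp [this]
      · simp [hq]
    refine ⟨fun q => ?_, hs.next_le, ?_, ?_, ?_, ?_⟩
    · rcases eq_or_ne q p with rfl | hq
      · simpa [State.setLoc] using hl
      · simpa [State.setLoc, hq] using hs.loc q
    · intro q i
      rcases eq_or_ne q p with rfl | hq
      · have h1 := hs.one_le_pos q q
        simp only [State.setLoc, Function.update_self, LocalState.record]
        rcases eq_or_ne i ((s.loc q).pos q) with rfl | hi
        · simp only [Function.update_self]; omega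
        · simp only [Function.update_of_ne hi, hs.done_pos]; omega
      · simpa [State.setLoc, hq] using hs.done_pos q i
    · intro r q
      rcases eq_or_ne r p with rfl | hr
      · rcases eq_or_ne q r with rfl | hq
        · simp [State.setLoc, LocalState.record]
        · simpa [State.setLoc, LocalState.record, hq] using hs.one_le_pos r q
      · simpa [State.setLoc, hr] using hs.one_le_pos r q
    · intro r q
      have h1 := hs.pos_le_pos r q
      rcases eq_or_ne r p with rfl | hr
      · rcases eq_or_ne q r with rfl | hq
        · exact le_rfl
        · simpa [State.setLoc, LocalState.record, hq] using h1
      · rcases eq_or_ne q p with rfl | hq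
        · simp [State.setLoc, LocalState.record, hr]; omega
        · simpa [State.setLoc, hr, hq] using h1
    · intro r z
      rcases eq_or_ne r p with rfl | hr
      · simp only [State.setLoc, Function.update_self, LocalState.record, Finset.mem_insert,
          hs.mem_done]
        constructor
        · rintro (rfl | ⟨q, i, h1, h2, h3⟩)
          · exact ⟨r, (s.loc r).pos r, hs.one_le_pos _ _, by simp, by simp⟩
          · refine ⟨q, i, h1, ?_, by rw [hold r q i h1 h2, h3]⟩
            rcases eq_or_ne q r with rfl | hq
            · simp; omega
            · simpa [hq] using h2
        · rintro ⟨q, i, h1, h2, h3⟩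
          rcases eq_or_ne q r with rfl | hq
          · simp only [Function.update_self] at h2 h3
            rcases Nat.lt_succ_iff_lt_or_eq.1 h2 with h4 | h4
            · exact Or.inr ⟨q, i, h1, h4, by simpa [h4.ne] using h3⟩
            · left; rw [← h3, h4]; simp
          · exact Or.inr ⟨q, i, h1, by simpa [hq] using h2, by simpa [hq] using h3⟩
      · simp only [State.setLoc, Function.update_of_ne hr, hs.mem_done]
        refine exists_congr fun q => exists_congr fun i => ?_
        constructor
        · rintro ⟨h1, h2, h3⟩; exact ⟨h1, h2, by rw [hold r q i h1 h2, h3]⟩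
        · rintro ⟨h1, h2, h3⟩; exact ⟨h1, h2, by rw [← h3, hold r q i h1 h2]⟩

theorem Execution.inv (hβ : m ≤ β) (e : Execution (algorithm n m β)) (k : ℕ)
    (hk : (k : ℕ∞) ≤ e.len) : Inv n β (e.state k) := by
  induction k with
  | zero =>
    have : e.state 0 = initState n m := e.start_mem
    rw [this]; exact inv_init
  | succ k ih =>
    have hlt : (k : ℕ∞) < e.len := lt_of_lt_of_le (by exact_mod_cast Nat.lt_succ_self k) hk
    exact (ih hlt.le).step hβ (e.step k hlt)

open Filter

/-! ### Effects on single fields -/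

theorem LocalState.advance_free (l : LocalState m) (st : Status) :
    (l.advance st).free = l.free := by
  unfold LocalState.advance; split_ifs <;> rfl

theorem LocalState.advance_try (l : LocalState m) (st : Status) :
    (l.advance st).try_ = l.try_ := by
  unfold LocalState.advance; split_ifs <;> rfl

theorem LocalState.advance_nxt (l : LocalState m) (st : Status) :
    (l.advance st).nxt = l.nxt := by
  unfold LocalState.advance; split_ifs <;> rfl

theorem LocalState.advance_spec (l : LocalState m) (st : Status) :
    (l.q.val + 1 < m ∧ (l.advance st).status = l.status ∧ (l.advance st).q.val = l.q.val + 1) ∨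
    (l.q.val + 1 = m ∧ (l.advance st).status = st ∧ (l.advance st).q.val = 0) := by
  unfold LocalState.advance
  split_ifs with h
  · exact Or.inl ⟨h, rfl, rfl⟩
  · exact Or.inr ⟨by have := l.q.2; omega, rfl, rfl⟩

/-- The state of a process right after reading one cell of `next`. -/
def LocalState.readTry (n : ℕ) (next : Fin m → ℕ) (p : Fin m) (l : LocalState m) : LocalState m :=
  if l.q ≠ p ∧ next l.q ≤ n then { l with try_ := insert (next l.q) l.try_ } else l

theorem LocalState.gatherTry_eq (next : Fin m → ℕ) (p : Fin m) (l : LocalState m) :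
    l.gatherTry n next p = (l.readTry n next p).advance .gatherDone := rfl

theorem LocalState.readTry_eq (next : Fin m → ℕ) (p : Fin m) (l : LocalState m) :
    l.readTry n next p = { l with try_ := (l.readTry n next p).try_ } := by
  unfold LocalState.readTry; split_ifs <;> rfl

theorem LocalState.readTry_q (next : Fin m → ℕ) (p : Fin m) (l : LocalState m) :
    (l.readTry n next p).q = l.q := by rw [readTry_eq]

theorem LocalState.readTry_status (next : Fin m → ℕ) (p : Fin m) (l : LocalState m) :
    (l.readTry n next p).status = l.status := by rw [readTry_eq]

theorem LocalState.mem_readTry (next : Fin m → ℕ) (p : Fin m) (l : LocalState m)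
    (hn : ∀ q, next q ≤ n) (z : ℕ) :
    z ∈ (l.readTry n next p).try_ ↔ z ∈ l.try_ ∨ l.q ≠ p ∧ z = next l.q := by
  unfold LocalState.readTry
  split_ifs with h
  · simp only [Finset.mem_insert]; tauto
  · have := hn l.q; tauto

/-! ### Runs without progress -/

/-- The steps of process `p` that neither perform a job nor learn of one. -/
inductive QuietStep (n β : ℕ) (p : Fin m) (s : State m) : State m → Prop
  | compNext (hst : (s.loc p).status = .compNext)
      (hβ : β ≤ ((s.loc p).free \ (s.loc p).try_).card) :
      QuietStep n β p s (s.setLoc p ((s.loc p).compNext β p))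
  | setNext (hst : (s.loc p).status = .setNext) :
      QuietStep n β p s { s.setLoc p { s.loc p with status := .gatherTry } with
        next := Function.update s.next p (s.loc p).nxt }
  | gatherTry (hst : (s.loc p).status = .gatherTry) :
      QuietStep n β p s (s.setLoc p ((s.loc p).gatherTry n s.next p))
  | gatherDone (hst : (s.loc p).status = .gatherDone)
      (hif : ¬ ((s.loc p).q ≠ p ∧ (s.loc p).pos (s.loc p).q ≤ n ∧
        0 < s.done (s.loc p).q ((s.loc p).pos (s.loc p).q))) :
      QuietStep n β p s (s.setLoc p ((s.loc p).advance .check))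
  | check (hst : (s.loc p).status = .check)
      (hif : (s.loc p).nxt ∈ (s.loc p).try_ ∨ (s.loc p).nxt ∈ (s.loc p).done) :
      QuietStep n β p s (s.setLoc p { s.loc p with status := .compNext })

theorem QuietStep.of_ne {p q : Fin m} {s s' : State m} (h : QuietStep n β p s s') (hq : q ≠ p) :
    s'.loc q = s.loc q ∧ s'.next q = s.next q := by
  cases h <;> simp [State.setLoc, hq]

theorem QuietStep.const {p : Fin m} {s s' : State m} (h : QuietStep n β p s s') (q : Fin m) :
    (s'.loc q).free = (s.loc q).free ∧ (s'.loc q).pos = (s.loc q).pos := by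
  rcases eq_or_ne q p with rfl | hq
  · cases h with
    | compNext hst hβ => simp [State.setLoc, LocalState.compNext, if_pos hβ]
    | setNext hst => simp [State.setLoc]
    | gatherTry hst =>
      simp only [State.setLoc, Function.update_self, LocalState.gatherTry_eq,
        LocalState.advance_free, LocalState.advance_pos]
      rw [LocalState.readTry_eq]
      simp
    | gatherDone hst hif =>
      simp [State.setLoc, LocalState.advance_free, LocalState.advance_pos]
    | check hst hif => simp [State.setLoc]
  · rw [(h.of_ne hq).1]; simp

/-- The number of steps until the next `compNext`, in a run without progress. -/
def LocalState.stepsLeft (l : LocalState m) : ℕ :=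
  match l.status with
  | .check => 1
  | .gatherDone => m + 1 - l.q.val
  | .gatherTry => 2 * m + 2 - l.q.val
  | .setNext => 2 * m + 3
  | _ => 0

/-- Without news a cycle runs through its statuses in a fixed order and each read moves the loop
index. Only the strict decrease is used; the values before `gatherDone` overestimate the number of
steps. -/
theorem QuietStep.stepsLeft_lt {p : Fin m} {s s' : State m} (h : QuietStep n β p s s')
    (hs : (s.loc p).status ≠ .compNext) : (s'.loc p).stepsLeft < (s.loc p).stepsLeft := by
  have hq := (s.loc p).q.2
  cases h with
  | compNext hst hβ => exact absurd hst hs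
  | setNext hst =>
    simp only [State.setLoc, Function.update_self, LocalState.stepsLeft, hst]
    omega
  | gatherTry hst =>
    simp only [State.setLoc, Function.update_self, LocalState.gatherTry_eq]
    have h1 := ((s.loc p).readTry n s.next p).advance_spec .gatherDone
    rw [LocalState.readTry_q, LocalState.readTry_status] at h1
    rcases h1 with ⟨h1, h2, h3⟩ | ⟨h1, h2, h3⟩
    · simp only [LocalState.stepsLeft, h2, h3, hst]; omega
    · simp only [LocalState.stepsLeft, h2, h3, hst]; omega
  | gatherDone hst hif =>
    simp only [State.setLoc, Function.update_self]
    rcases (s.loc p).advance_spec .check with ⟨h1, h2, h3⟩ | ⟨h1, h2, h3⟩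
    · simp only [LocalState.stepsLeft, h2, h3, hst]; omega
    · simp only [LocalState.stepsLeft, h2, hst]; omega
  | check hst hif =>
    simp [State.setLoc, LocalState.stepsLeft, hst]

/-- An infinite run, started anywhere, in which only the processes in `L` take steps, each of
them infinitely many, and no job is performed or learned of. -/
structure QuietRun (n β : ℕ) (L : Set (Fin m)) (st : ℕ → State m) (who : ℕ → Fin m) : Prop where
  inv : ∀ k, Inv n β (st k)
  who_mem : ∀ k, who k ∈ L
  often : ∀ p ∈ L, ∃ᶠ k in atTop, who k = p
  step : ∀ k, QuietStep n β (who k) (st k) (st (k + 1))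

namespace QuietRun

variable {L : Set (Fin m)} {st : ℕ → State m} {who : ℕ → Fin m}

theorem free_eq (h : QuietRun n β L st who) (k : ℕ) (p : Fin m) :
    ((st k).loc p).free = ((st 0).loc p).free := by
  induction k with
  | zero => rfl
  | succ k ih => rw [((h.step k).const p).1, ih]

theorem pos_eq (h : QuietRun n β L st who) (k : ℕ) (p : Fin m) :
    ((st k).loc p).pos = ((st 0).loc p).pos := by
  induction k with
  | zero => rfl
  | succ k ih => rw [((h.step k).const p).2, ih]

theorem next_eq (h : QuietRun n β L st who) (k : ℕ) {p : Fin m} (hp : p ∉ L) :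
    (st k).next p = (st 0).next p := by
  induction k with
  | zero => rfl
  | succ k ih =>
    rw [((h.step k).of_ne (q := p) fun e => hp (e ▸ h.who_mem k)).2, ih]

theorem exists_step (h : QuietRun n β L st who) {p : Fin m} (hp : p ∈ L) (k : ℕ) :
    ∃ k' ≥ k, who k' = p ∧ (st k').loc p = (st k).loc p := by
  obtain ⟨j, hj, hw⟩ := (frequently_atTop.1 (h.often p hp)) k
  obtain ⟨d, rfl⟩ := Nat.exists_eq_add_of_le hj
  clear hj
  induction d generalizing k with
  | zero => exact ⟨k, le_rfl, hw, rfl⟩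
  | succ d ih =>
    by_cases hk : who k = p
    · exact ⟨k, le_rfl, hk, rfl⟩
    · obtain ⟨k', h1, h2, h3⟩ := ih (k + 1) (by rw [← hw]; congr 1; omega)
      exact ⟨k', by omega, h2, by rw [h3, ((h.step k).of_ne (Ne.symm hk)).1]⟩

theorem exists_compNext (h : QuietRun n β L st who) {p : Fin m} (hp : p ∈ L) (k : ℕ) :
    ∃ k' ≥ k, who k' = p ∧ ((st k').loc p).status = .compNext := by
  induction hd : ((st k).loc p).stepsLeft using Nat.strong_induction_on generalizing k with
  | _ d ih =>
    obtain ⟨k₁, h1, h2, h3⟩ := h.exists_step hp k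
    by_cases hc : ((st k₁).loc p).status = .compNext
    · exact ⟨k₁, h1, h2, hc⟩
    · have hs := h.step k₁
      rw [h2] at hs
      have hlt := hs.stepsLeft_lt hc
      rw [h3, hd] at hlt
      obtain ⟨k', h4, h5⟩ := ih _ hlt (k₁ + 1) rfl
      exact ⟨k', by omega, h5⟩

/-- A property that holds after every `compNext` of `p` and is stable holds eventually. -/
theorem eventually_of_stable (h : QuietRun n β L st who) {p : Fin m} (hp : p ∈ L)
    {P : State m → Prop}
    (hcomp : ∀ᶠ k in atTop, who k = p → ((st k).loc p).status = .compNext → P (st (k + 1)))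
    (hstep : ∀ᶠ k in atTop, P (st k) → P (st (k + 1))) : ∀ᶠ k in atTop, P (st k) := by
  obtain ⟨K, hK⟩ := eventually_atTop.1 (hcomp.and hstep)
  obtain ⟨k, hk, h1, h2⟩ := h.exists_compNext hp K
  refine eventually_atTop.2 ⟨k + 1, fun j hj => ?_⟩
  induction j, hj using Nat.le_induction with
  | base => exact (hK k hk).1 h1 h2
  | succ j hj ih => exact (hK j (by omega)).2 ih

/-- It suffices to check stability for the steps of `p` if the property only concerns `p`. -/
theorem eventually_of_stable_loc (h : QuietRun n β L st who) {p : Fin m} (hp : p ∈ L)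
    {P : LocalState m → ℕ → Prop}
    (hcomp : ∀ᶠ k in atTop, who k = p → ((st k).loc p).status = .compNext →
      P ((st (k + 1)).loc p) ((st (k + 1)).next p))
    (hstep : ∀ᶠ k in atTop, who k = p → P ((st k).loc p) ((st k).next p) →
      P ((st (k + 1)).loc p) ((st (k + 1)).next p)) :
    ∀ᶠ k in atTop, P ((st k).loc p) ((st k).next p) := by
  refine h.eventually_of_stable hp (P := fun s => P (s.loc p) (s.next p)) hcomp ?_
  filter_upwards [hstep] with k hk hP
  by_cases hw : who k = p
  · exact hk hw hP
  · have := (h.step k).of_ne (Ne.symm hw)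
    rwa [this.1, this.2]

/-- A quiet process leaves row `j` only at an unfilled cell, hence after reading everything that `j`
recorded. Pointers are constant in a quiet run, so one complete pass settles the equality already
for the initial state. -/
theorem pos_eq_diag (h : QuietRun n β L st who) {p : Fin m} (hp : p ∈ L) (j : Fin m) :
    ((st 0).loc p).pos j = ((st 0).loc j).pos j := by
  rcases eq_or_ne j p with rfl | hjp
  · rfl
  have key := h.eventually_of_stable_loc hp (P := fun l _ =>
    (l.status = .gatherDone → j < l.q → ((st 0).loc p).pos j = ((st 0).loc j).pos j) ∧
    (l.status = .check ∨ l.status = .compNext →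
      ((st 0).loc p).pos j = ((st 0).loc j).pos j)) ?_ ?_
  · obtain ⟨K, hK⟩ := eventually_atTop.1 key
    obtain ⟨k, hk, -, h2⟩ := h.exists_compNext hp K
    exact (hK k hk).2 (Or.inr h2)
  · refine Eventually.of_forall fun k hw hst => ?_
    have hs := h.step k
    rw [hw] at hs
    generalize st (k + 1) = s' at hs
    cases hs with
    | compNext hst' hβ => simp [State.setLoc, LocalState.compNext, hβ]
    | _ hst' => simp [hst] at hst'
  · refine Eventually.of_forall fun k hw hP => ?_
    have hs := h.step k
    have hinv := h.inv k
    have hpos := h.pos_eq k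
    rw [hw] at hs
    generalize st (k + 1) = s' at hs
    cases hs with
    | compNext hst hβ => simp [State.setLoc, LocalState.compNext, hβ]
    | setNext hst => simp [State.setLoc]
    | gatherTry hst =>
      simp only [State.setLoc, Function.update_self, LocalState.gatherTry_eq]
      have h1 := (((st k).loc p).readTry n (st k).next p).advance_spec .gatherDone
      rw [LocalState.readTry_q, LocalState.readTry_status] at h1
      rcases h1 with ⟨h1, h2, h3⟩ | ⟨h1, h2, h3⟩
      · simp [h2, hst]
      · simp [h2, Fin.lt_def, h3]
    | gatherDone hst hif =>
      have hread : j = ((st k).loc p).q → ((st 0).loc p).pos j = ((st 0).loc j).pos j := by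
        intro hj
        rw [← hj] at hif
        have h1 := hinv.done_pos j (((st k).loc p).pos j)
        have h2 := hinv.pos_le_pos p j
        have h3 := (hinv.loc j).pos_le
        have h4 := hinv.one_le_pos p j
        rw [hpos p, hpos j] at *
        -- If the pointers differed, the cell at the pointer of `p` would be filled, in a column at
        -- most n by `pos_le`, and `p` would have read it.
        by_contra hne
        exact hif ⟨hjp, by omega, h1.2 ⟨h4, by omega⟩⟩
      have hle : j ≤ ((st k).loc p).q → ((st 0).loc p).pos j = ((st 0).loc j).pos j := by
        intro hj
        rcases hj.lt_or_eq with hj | hj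
        · exact hP.1 hst hj
        · exact hread hj
      simp only [State.setLoc, Function.update_self]
      rcases ((st k).loc p).advance_spec .check with ⟨h1, h2, h3⟩ | ⟨h1, h2, h3⟩
      · simp only [h2, h3, hst, Fin.lt_def]
        exact ⟨fun _ hj => hle (by rw [Fin.le_def]; omega), by simp⟩
      · simp only [h2]
        exact ⟨by simp, fun _ => hle (by rw [Fin.le_def]; omega)⟩
    | check hst hif =>
      simp only [State.setLoc, Function.update_self]
      exact ⟨by simp, fun _ => hP.2 (Or.inl hst)⟩

/-- The pointers determine which matrix entries form DONE, and by `pos_eq_diag` they agree for all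
members of `L`. -/
theorem free_eq_free (h : QuietRun n β L st who) {p q : Fin m} (hp : p ∈ L) (hq : q ∈ L) :
    ((st 0).loc p).free = ((st 0).loc q).free := by
  rw [((h.inv 0).loc p).free_eq, ((h.inv 0).loc q).free_eq]
  congr 1
  ext z
  simp only [(h.inv 0).mem_done, h.pos_eq_diag hp, h.pos_eq_diag hq]

/-- The announcements of the processes outside `L` are eventually known to every process. -/
theorem eventually_next_mem_try (h : QuietRun n β L st who) {p j : Fin m} (hp : p ∈ L)
    (hj : j ∉ L) : ∀ᶠ k in atTop,
      ((st k).loc p).status = .compNext → (st 0).next j ∈ ((st k).loc p).try_ := by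
  have hjp : j ≠ p := fun e => hj (e ▸ hp)
  have key := h.eventually_of_stable_loc hp (P := fun l _ =>
    (l.status = .gatherTry → j < l.q → (st 0).next j ∈ l.try_) ∧
    (l.status = .gatherDone ∨ l.status = .check ∨ l.status = .compNext →
      (st 0).next j ∈ l.try_)) ?_ ?_
  · filter_upwards [key] with k hk hst
    exact hk.2 (Or.inr (Or.inr hst))
  · refine Eventually.of_forall fun k hw hst => ?_
    have hs := h.step k
    rw [hw] at hs
    generalize st (k + 1) = s' at hs
    cases hs with
    | compNext hst' hβ => simp [State.setLoc, LocalState.compNext, hβ]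
    | _ hst' => simp [hst] at hst'
  · refine Eventually.of_forall fun k hw hP => ?_
    have hs := h.step k
    have hinv := h.inv k
    have hnext := h.next_eq k hj
    rw [hw] at hs
    generalize st (k + 1) = s' at hs
    cases hs with
    | compNext hst hβ => simp [State.setLoc, LocalState.compNext, hβ]
    | setNext hst =>
      -- The loop index is 0 here, so no cell counts as visited and the claim is vacuous.
      have := ((hinv.loc p).of_setNext hst).2
      simp [State.setLoc, Fin.lt_def, this]
    | gatherTry hst =>
      simp only [State.setLoc, Function.update_self, LocalState.gatherTry_eq,
        LocalState.advance_try, LocalState.mem_readTry _ _ _ hinv.next_le]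
      have hle : j ≤ ((st k).loc p).q → (st 0).next j ∈ ((st k).loc p).try_ ∨
          ((st k).loc p).q ≠ p ∧ (st 0).next j = (st k).next ((st k).loc p).q := by
        intro hjq
        rcases hjq.lt_or_eq with hjq | hjq
        · exact Or.inl (hP.1 hst hjq)
        · exact Or.inr ⟨hjq ▸ hjp, by rw [← hjq, hnext]⟩
      have h1 := (((st k).loc p).readTry n (st k).next p).advance_spec .gatherDone
      rw [LocalState.readTry_q, LocalState.readTry_status] at h1
      rcases h1 with ⟨h1, h2, h3⟩ | ⟨h1, h2, h3⟩
      · simp only [h2, hst, Fin.lt_def, h3]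
        exact ⟨fun _ hjq => hle (by rw [Fin.le_def]; omega), by simp⟩
      · simp only [h2]
        exact ⟨by simp, fun _ => hle (by rw [Fin.le_def]; omega)⟩
    | gatherDone hst hif =>
      simp only [State.setLoc, Function.update_self, LocalState.advance_try]
      have hmem := hP.2 (Or.inl hst)
      exact ⟨fun _ _ => hmem, fun _ => hmem⟩
    | check hst hif =>
      simp only [State.setLoc, Function.update_self]
      have hmem := hP.2 (Or.inr (Or.inl hst))
      exact ⟨fun _ _ => hmem, fun _ => hmem⟩

/-- A property of the jobs that `p` selects eventually holds for `next p`. -/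
theorem eventually_nxt (h : QuietRun n β L st who) {p : Fin m} (hp : p ∈ L) {Q : ℕ → Prop}
    (hQ : ∀ᶠ k in atTop, ((st k).loc p).status = .compNext →
      β ≤ (((st k).loc p).free \ ((st k).loc p).try_).card →
      Q (elementOfRank (((st k).loc p).free \ ((st k).loc p).try_)
        (chosenRank m ((st k).loc p).free.card p))) :
    ∀ᶠ k in atTop, Q ((st k).loc p).nxt := by
  have hnew : ∀ᶠ k in atTop, who k = p → ((st k).loc p).status = .compNext →
      Q ((st (k + 1)).loc p).nxt := by
    filter_upwards [hQ] with k hk hw hst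
    have hs := h.step k
    rw [hw] at hs
    generalize st (k + 1) = s' at hs
    cases hs with
    | compNext hst' hβ => simpa [State.setLoc, LocalState.compNext, hβ] using hk hst hβ
    | _ hst' => simp [hst] at hst'
  refine h.eventually_of_stable_loc hp (P := fun l _ => Q l.nxt) hnew ?_
  filter_upwards [hnew] with k hk hw hP
  have hs := h.step k
  rw [hw] at hs
  generalize st (k + 1) = s' at hs hk
  cases hs with
  | compNext hst hβ => exact hk hw hst
  | gatherTry hst =>
    simp only [State.setLoc, Function.update_self, LocalState.gatherTry_eq,
      LocalState.advance_nxt]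
    rw [LocalState.readTry_eq]
    exact hP
  | _ hst => simpa [State.setLoc, LocalState.advance_nxt] using hP

/-- After `compNext` the cell still holds the previous announcement. The property is therefore first
obtained outside status `setNext`, and then at all late times because an old good value is replaced
only by a good one. -/
theorem eventually_next (h : QuietRun n β L st who) {p : Fin m} (hp : p ∈ L) {Q : ℕ → Prop}
    (hQ : ∀ᶠ k in atTop, Q ((st k).loc p).nxt) : ∀ᶠ k in atTop, Q ((st k).next p) := by
  have key := h.eventually_of_stable_loc hp (P := fun l x => l.status ≠ .setNext → Q x) ?_ ?_
  · refine h.eventually_of_stable_loc hp (P := fun _ x => Q x) ?_ ?_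
    · filter_upwards [key] with k hk hw hst
      have hk := hk (by simp [hst])
      have hs := h.step k
      rw [hw] at hs
      generalize st (k + 1) = s' at hs
      cases hs with
      | compNext => exact hk
      | _ hst' => simp [hst] at hst'
    · filter_upwards [hQ] with k hk hw hP
      have hs := h.step k
      rw [hw] at hs
      generalize st (k + 1) = s' at hs
      cases hs with
      | setNext => simpa using hk
      | _ hst' => exact hP
  · refine Eventually.of_forall fun k hw hst => ?_
    have hs := h.step k
    rw [hw] at hs
    generalize st (k + 1) = s' at hs
    cases hs with
    | compNext hst' hβ => simp [State.setLoc, LocalState.compNext, hβ]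
    | _ hst' => simp [hst] at hst'
  · filter_upwards [hQ] with k hk hw hP
    have hs := h.step k
    rw [hw] at hs
    generalize st (k + 1) = s' at hs
    cases hs with
    | setNext => intro _; simpa using hk
    | _ hst' => exact fun _ => hP (by simp [hst'])

/-- A property of all announced jobs eventually holds for all members of `TRY`. -/
theorem eventually_try (h : QuietRun n β L st who) {p : Fin m} (hp : p ∈ L) {Q : ℕ → Prop}
    (hQ : ∀ᶠ k in atTop, ∀ j ≠ p, Q ((st k).next j)) :
    ∀ᶠ k in atTop, ∀ z ∈ ((st k).loc p).try_, Q z := by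
  refine h.eventually_of_stable_loc hp (P := fun l _ => ∀ z ∈ l.try_, Q z) ?_ ?_
  · refine Eventually.of_forall fun k hw hst => ?_
    have hs := h.step k
    rw [hw] at hs
    generalize st (k + 1) = s' at hs
    cases hs with
    | compNext hst' hβ => simp [State.setLoc, LocalState.compNext, hβ]
    | _ hst' => simp [hst] at hst'
  · filter_upwards [hQ] with k hk hw hP
    have hs := h.step k
    have hinv := h.inv k
    rw [hw] at hs
    generalize st (k + 1) = s' at hs
    cases hs with
    | compNext hst' hβ => simp [State.setLoc, LocalState.compNext, hβ]
    | gatherTry hst =>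
      simp only [State.setLoc, Function.update_self, LocalState.gatherTry_eq,
        LocalState.advance_try, LocalState.mem_readTry _ _ _ hinv.next_le]
      rintro z (hz | ⟨hz, rfl⟩)
      · exact hP z hz
      · exact hk _ hz
    | _ hst => simpa [State.setLoc, LocalState.advance_try] using hP

theorem elim (h : QuietRun n β L st who) (hβ : m ≤ β) : False := by
  classical
  obtain ⟨p, hp, hmin⟩ : ∃ p ∈ L, ∀ q ∈ L, p ≤ q := by
    obtain ⟨p, hp⟩ := Set.exists_min_image L id (Set.toFinite L) ⟨who 0, h.who_mem 0⟩
    exact ⟨p, hp⟩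
  set G := ((st 0).loc p).free with hG
  have hfree : ∀ k, ∀ q ∈ L, ((st k).loc q).free = G := fun k q hq => by
    rw [h.free_eq, h.free_eq_free hq hp]
  set S := (Finset.univ.filter (· ∉ L)).image (st 0).next with hS
  set F := G \ S with hF
  set r : Fin m → ℕ := fun q => chosenRank m G.card q with hr
  have hsub : ∀ q ∈ L, ∀ᶠ k in atTop, ((st k).loc q).status = .compNext →
      S ⊆ ((st k).loc q).try_ := by
    intro q hq
    have : ∀ᶠ k in atTop, ∀ j, j ∉ L → ((st k).loc q).status = .compNext →
        (st 0).next j ∈ ((st k).loc q).try_ := by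
      rw [eventually_all]
      intro j
      by_cases hj : j ∈ L
      · simp [hj]
      · filter_upwards [h.eventually_next_mem_try hq hj] with k hk _ using hk
    filter_upwards [this] with k hk hst z hz
    obtain ⟨j, hj, rfl⟩ := Finset.mem_image.1 hz
    exact hk j (Finset.mem_filter.1 hj).2 hst
  -- The announced job had rank `r q` in FREE \ TRY, eventually a subset of `F`; passing to the
  -- larger set can only increase the number of smaller elements.
  have hnext : ∀ᶠ k in atTop, ∀ q ∈ L, r q ≤ below F ((st k).next q) + 1 := by
    rw [eventually_all]
    intro q
    by_cases hq : q ∈ L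
    swap
    · simp [hq]
    have := h.eventually_next hq (Q := fun x => r q ≤ below F x + 1) <|
        h.eventually_nxt hq (Q := fun x => r q ≤ below F x + 1) <| by
      filter_upwards [hsub q hq] with k hk hst hcard
      have hle := ((h.inv k).loc q).rank_le hβ hcard
      have h1 := below_elementOfRank (one_le_chosenRank _ _ _) hle
      rw [hfree k q hq] at h1 ⊢
      have h2 := below_mono (Finset.sdiff_subset_sdiff (Finset.Subset.refl G) (hk hst))
        (elementOfRank (G \ ((st k).loc q).try_) (chosenRank m G.card q))
      change chosenRank m G.card q ≤ below (G \ S) _ + 1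
      omega
    filter_upwards [this] with k hk _ using hk
  -- By minimality of `p` and strict monotonicity of ranks, every other live announcement has at
  -- least `r p` elements of `F` below it.
  have htry : ∀ᶠ k in atTop, ∀ z ∈ ((st k).loc p).try_, z ∈ S ∨ r p ≤ below F z := by
    refine h.eventually_try hp ?_
    filter_upwards [hnext] with k hk j hj
    by_cases hjL : j ∈ L
    · have h1 : r p < r j :=
        chosenRank_strictMono m _ (Fin.lt_def.1 (lt_of_le_of_ne (hmin j hjL) hj.symm))
      have h2 := hk j hjL
      exact Or.inr (by omega)
    · exact Or.inl (Finset.mem_image.2 ⟨j, by simp [hjL], (h.next_eq k hjL).symm⟩)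
  have hrF : r p ≤ F.card := by
    obtain ⟨K, hK⟩ := eventually_atTop.1 (hsub p hp)
    obtain ⟨k, hk, hw, hst⟩ := h.exists_compNext hp K
    have hs := h.step k
    rw [hw] at hs
    generalize st (k + 1) = s' at hs
    cases hs with
    | compNext hst' hcard =>
      have h1 := ((h.inv k).loc p).rank_le hβ hcard
      rw [hfree k p hp] at h1
      exact h1.trans (Finset.card_le_card
        (Finset.sdiff_subset_sdiff (Finset.Subset.refl G) (hK k hk hst)))
    | _ hst' => simp [hst] at hst'
  set x := elementOfRank F (r p) with hx
  have hxF : x ∈ F := elementOfRank_mem (one_le_chosenRank _ _ _) hrF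
  have hbx : below F x = r p - 1 := below_elementOfRank (one_le_chosenRank _ _ _) hrF
  have hr1 : 1 ≤ r p := one_le_chosenRank _ _ _
  -- Elements of `F` up to `x` have fewer than `r p` elements of `F` below them, so such a set `T`
  -- cannot contain them.
  have hnot : ∀ T : Finset ℕ, (∀ z ∈ T, z ∈ S ∨ r p ≤ below F z) → ∀ y ∈ F, y ≤ x → y ∉ T := by
    intro T hT y hy hyx hyT
    rcases hT y hyT with h1 | h1
    · exact (Finset.mem_sdiff.1 hy).2 h1
    · rcases hyx.lt_or_eq with h2 | h2
      · have := below_lt_of_lt hy h2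
        omega
      · rw [h2] at h1; omega
  have hnxt : ∀ᶠ k in atTop, ((st k).loc p).nxt = x := by
    refine h.eventually_nxt hp (Q := (· = x)) ?_
    filter_upwards [htry, hsub p hp] with k hk hk' hst hcard
    rw [hfree k p hp]
    -- Up to `x` the sets FREE \ TRY and `F` coincide, so `x` has rank `r p` in both.
    have hmem : ∀ y ≤ x, y ∈ G \ ((st k).loc p).try_ ↔ y ∈ F := by
      intro y hy
      constructor
      · exact fun h1 => Finset.sdiff_subset_sdiff (Finset.Subset.refl G) (hk' hst) h1
      · exact fun h1 => Finset.mem_sdiff.2 ⟨(Finset.mem_sdiff.1 h1).1, hnot _ hk y h1 hy⟩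
    refine elementOfRank_eq (one_le_chosenRank _ _ _) ((hmem x le_rfl).2 hxF) ?_
    change _ = r p - 1
    rw [← hbx, below, below]
    congr 1
    ext y
    simp only [Finset.mem_filter]
    exact ⟨fun h1 => ⟨(hmem y h1.2.le).1 h1.1, h1.2⟩, fun h1 => ⟨(hmem y h1.2.le).2 h1.1, h1.2⟩⟩
  have hfin : ∀ᶠ k in atTop, ((st k).loc p).status ≠ .compNext := by
    refine h.eventually_of_stable_loc hp (P := fun l _ => l.status ≠ .compNext) ?_ ?_
    · refine Eventually.of_forall fun k hw hst => ?_
      have hs := h.step k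
      rw [hw] at hs
      generalize st (k + 1) = s' at hs
      cases hs with
      | compNext hst' hβ => simp [State.setLoc, LocalState.compNext, hβ]
      | _ hst' => simp [hst] at hst'
    · filter_upwards [htry, hnxt] with k hk hk' hw hP
      have hs := h.step k
      rw [hw] at hs
      generalize st (k + 1) = s' at hs
      cases hs with
      | compNext hst' => exact absurd hst' hP
      | setNext => simp [State.setLoc]
      | gatherTry hst =>
        simp only [State.setLoc, Function.update_self, LocalState.gatherTry_eq]
        have h1 := (((st k).loc p).readTry n (st k).next p).advance_spec .gatherDone
        rw [LocalState.readTry_status] at h1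
        rcases h1 with ⟨h1, h2, h3⟩ | ⟨h1, h2, h3⟩ <;> simp [h2, hst]
      | gatherDone hst hif =>
        simp only [State.setLoc, Function.update_self]
        rcases ((st k).loc p).advance_spec .check with ⟨h1, h2, h3⟩ | ⟨h1, h2, h3⟩ <;>
          simp [h2, hst]
      -- A quiet check needs a conflict, but `x` is neither in TRY nor in DONE. So `p` can never
      -- return to `compNext`, contrary to `exists_compNext`.
      | check hst hif =>
        exfalso
        rw [hk'] at hif
        rcases hif with h1 | h1
        · exact hnot _ hk x hxF le_rfl h1
        · have h2 := (Finset.mem_sdiff.1 hxF).1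
          rw [← hfree k p hp, ((h.inv k).loc p).free_eq] at h2
          exact (Finset.mem_sdiff.1 h2).2 h1
  obtain ⟨K, hK⟩ := eventually_atTop.1 hfin
  obtain ⟨k, hk, -, hst⟩ := h.exists_compNext hp K
  exact hK k hk hst

end QuietRun

/-! ### Every execution is finite -/

theorem exists_stable_of_monotone {g : ℕ → ℕ} (hg : Monotone g) {B : ℕ} (hB : ∀ k, g k ≤ B) :
    ∀ᶠ k in atTop, g (k + 1) = g k := by
  have hfin : (Set.range g).Finite := (Set.finite_Iic B).subset (by rintro _ ⟨k, rfl⟩; exact hB k)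
  obtain ⟨_, ⟨K, rfl⟩, hK⟩ := Set.exists_max_image (Set.range g) id hfin ⟨g 0, 0, rfl⟩
  refine eventually_atTop.2 ⟨K, fun k hk => ?_⟩
  have h1 := hK (g (k + 1)) ⟨_, rfl⟩
  have h2 := hg hk
  have h3 := hg (Nat.le_succ k)
  simp only [id] at h1
  exact le_antisymm (h1.trans h2) h3

theorem trans_pos_le {s s' : State m} {a : Action m} (h : trans n m β s a s') (p q : Fin m) :
    (s.loc p).pos q ≤ (s'.loc p).pos q := by
  by_cases hp : p = a.actor
  swap
  · rw [(trans_of_actor_ne h hp).1]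
  have hup : ∀ (f : Fin m → ℕ) (r : Fin m), f q ≤ Function.update f r (f r + 1) q := by
    intro f r
    rcases eq_or_ne q r with rfl | hr
    · simp
    · simp [hr]
  cases a <;> simp only [Action.actor] at hp <;> subst hp
  case perform j => obtain ⟨_, _, rfl⟩ := h; simp [State.setLoc]
  case compNext =>
    obtain ⟨_, rfl⟩ := h
    simp only [State.setLoc, Function.update_self, LocalState.compNext]
    split_ifs <;> exact le_rfl
  case gatherTry =>
    obtain ⟨_, rfl⟩ := h
    simp only [State.setLoc, Function.update_self, LocalState.gatherTry_eq, LocalState.advance_pos]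
    rw [LocalState.readTry_eq]
  case gatherDone =>
    obtain ⟨_, rfl⟩ := h
    simp only [State.setLoc, Function.update_self, LocalState.gatherDone]
    split_ifs
    · exact hup _ _
    · rw [LocalState.advance_pos]
  case check =>
    obtain ⟨_, rfl⟩ := h
    simp only [State.setLoc, Function.update_self, LocalState.check]
    split_ifs <;> exact le_rfl
  case record =>
    obtain ⟨_, rfl⟩ := h
    simpa [State.setLoc, LocalState.record] using hup _ _
  all_goals obtain ⟨_, rfl⟩ := h; simp [State.setLoc]

/-- There are no infinite runs. -/
theorem no_infinite_run (hβ : m ≤ β) {st : ℕ → State m} {act : ℕ → Action m}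
    (hinv : ∀ k, Inv n β (st k)) (hstep : ∀ k, trans n m β (st k) (act k) (st (k + 1))) :
    False := by
  set L : Set (Fin m) := {p | ∃ᶠ k in atTop, (act k).actor = p} with hL
  have hnext : ∀ p ∈ L, ∀ k, ∃ k' ≥ k, (act k').actor = p ∧ (st k').loc p = (st k).loc p := by
    intro p hp k
    obtain ⟨j, hj, hw⟩ := (frequently_atTop.1 hp) k
    obtain ⟨d, rfl⟩ := Nat.exists_eq_add_of_le hj
    clear hj
    induction d generalizing k with
    | zero => exact ⟨k, le_rfl, hw, rfl⟩
    | succ d ih =>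
      by_cases hk : (act k).actor = p
      · exact ⟨k, le_rfl, hk, rfl⟩
      · obtain ⟨k', h1, h2, h3⟩ := ih (k + 1) (by rw [← hw]; congr 2; omega)
        exact ⟨k', by omega, h2, by rw [h3, (trans_of_actor_ne (hstep k) (Ne.symm hk)).1]⟩
  have hwho : ∀ᶠ k in atTop, (act k).actor ∈ L := by
    have : ∀ᶠ k in atTop, ∀ p, p ∉ L → (act k).actor ≠ p := by
      rw [eventually_all]
      intro p
      by_cases hp : p ∈ L
      · simp [hp]
      · filter_upwards [not_frequently.1 hp] with k hk _ using hk
    filter_upwards [this] with k hk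
    by_contra hc
    exact hk _ hc rfl
  -- Pointers are monotone and at most n + 1, hence eventually constant; from then on nothing is
  -- learned or recorded.
  have hpos : ∀ᶠ k in atTop, ∀ p q, ((st (k + 1)).loc p).pos q = ((st k).loc p).pos q := by
    rw [eventually_all]; intro p
    rw [eventually_all]; intro q
    refine exists_stable_of_monotone (g := fun k => ((st k).loc p).pos q) (B := n + 1)
      (monotone_nat_of_le_succ fun k => trans_pos_le (hstep k) p q) fun k => ?_
    have h1 := (hinv k).pos_le_pos p q
    have h2 := ((hinv k).loc q).pos_le
    omega
  have hstopped : ∀ p ∈ L, ∀ k, ((st k).loc p).status ≠ .stopped := by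
    intro p hp k hst
    obtain ⟨k', -, h2, h3⟩ := hnext p hp k
    have hs := hstep k'
    rw [← h3] at hst
    generalize act k' = a at hs h2
    cases a <;> simp only [Action.actor] at h2 <;> subst h2 <;> simp [trans, hst] at hs
  have hcrash : ∀ p ∈ L, ∀ k, act k ≠ .crash p := by
    intro p hp k hk
    have hs := hstep k
    rw [hk] at hs
    apply hstopped p hp (k + 1)
    rw [hs.2]
    simp [State.setLoc]
  have hfinished : ∀ p ∈ L, ∀ k, ((st k).loc p).status ≠ .finished := by
    intro p hp k hst
    obtain ⟨k', -, h2, h3⟩ := hnext p hp k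
    have hs := hstep k'
    have hc := hcrash p hp k'
    rw [← h3] at hst
    generalize act k' = a at hs h2 hc
    cases a <;> simp only [Action.actor] at h2 <;> subst h2 <;> simp [trans, hst] at hs hc
  obtain ⟨K, hK⟩ := eventually_atTop.1 (hwho.and hpos)
  -- The next step of such a process would be to record, which moves its own pointer.
  have hrecord : ∀ p ∈ L, ∀ k ≥ K, ((st k).loc p).status ≠ .record := by
    intro p hp k hk hst
    obtain ⟨k', h1, h2, h3⟩ := hnext p hp k
    have hs := hstep k'
    have hc := hcrash p hp k'
    have hpp := (hK k' (by omega)).2 p p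
    rw [← h3] at hst
    generalize act k' = a at hs h2 hc
    cases a <;> simp only [Action.actor] at h2 <;> subst h2 <;> simp [trans, hst] at hs hc
    rw [hs] at hpp
    simp [State.setLoc, LocalState.record] at hpp
  have hperform : ∀ p ∈ L, ∀ k ≥ K, ((st k).loc p).status ≠ .perform := by
    intro p hp k hk hst
    obtain ⟨k', h1, h2, h3⟩ := hnext p hp k
    have hs := hstep k'
    have hc := hcrash p hp k'
    have hrec := hrecord p hp (k' + 1) (by omega)
    rw [← h3] at hst
    generalize act k' = a at hs h2 hc
    cases a <;> simp only [Action.actor] at h2 <;> subst h2 <;> simp [trans, hst] at hs hc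
    rw [hs.2] at hrec
    simp [State.setLoc] at hrec
  refine QuietRun.elim (n := n) (L := L) (st := fun k => st (K + k))
    (who := fun k => (act (K + k)).actor)
    ⟨fun k => hinv _, fun k => (hK _ (by omega)).1, fun p hp => ?_, fun k => ?_⟩ hβ
  · rw [frequently_atTop]
    intro a
    obtain ⟨b, hb, hb'⟩ := frequently_atTop.1 hp (K + a)
    exact ⟨b - K, by omega, by simpa [show K + (b - K) = b by omega] using hb'⟩
  · have hs := hstep (K + k)
    obtain ⟨hp, hpq⟩ := hK (K + k) (by omega)
    have hc := hcrash _ hp (K + k)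
    have hrec := hrecord _ hp (K + k) (by omega)
    have hper := hperform _ hp (K + k) (by omega)
    have hper' := hperform _ hp (K + k + 1) (by omega)
    have hfin' := hfinished _ hp (K + k + 1)
    change QuietStep n β _ (st (K + k)) (st (K + k + 1))
    generalize st (K + k + 1) = s' at *
    generalize act (K + k) = a at *
    cases a with
    | crash p => simp [Action.actor] at hc
    | compNext p =>
      obtain ⟨hst, rfl⟩ := hs
      by_cases hβ' : β ≤ (((st (K + k)).loc p).free \ ((st (K + k)).loc p).try_).card
      · exact .compNext hst hβ'
      · simp [Action.actor, State.setLoc, LocalState.compNext, hβ'] at hfin'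
    | setNext p => obtain ⟨hst, rfl⟩ := hs; exact .setNext hst
    | gatherTry p => obtain ⟨hst, rfl⟩ := hs; exact .gatherTry hst
    | gatherDone p =>
      obtain ⟨hst, rfl⟩ := hs
      by_cases hif : ((st (K + k)).loc p).q ≠ p ∧
          ((st (K + k)).loc p).pos ((st (K + k)).loc p).q ≤ n ∧
          0 < (st (K + k)).done ((st (K + k)).loc p).q
            (((st (K + k)).loc p).pos ((st (K + k)).loc p).q)
      · have := hpq p ((st (K + k)).loc p).q
        simp [State.setLoc, LocalState.gatherDone, hif] at this
      · have := QuietStep.gatherDone (β := β) hst hif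
        simpa only [LocalState.gatherDone, if_neg hif, Action.actor] using this
    | check p =>
      obtain ⟨hst, rfl⟩ := hs
      by_cases hif : ((st (K + k)).loc p).nxt ∉ ((st (K + k)).loc p).try_ ∧
          ((st (K + k)).loc p).nxt ∉ ((st (K + k)).loc p).done
      · simp [Action.actor, State.setLoc, LocalState.check, hif] at hper'
      · have := QuietStep.check (n := n) (β := β) hst (by tauto)
        simpa only [LocalState.check, if_neg hif, Action.actor] using this
    | perform p j => exact absurd hs.1 hper
    | record p => exact absurd hs.1 hrec

theorem Execution.len_ne_top (hβ : m ≤ β) (e : Execution (algorithm n m β)) : e.len ≠ ⊤ := by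
  intro h
  exact no_infinite_run hβ (fun k => e.inv hβ k (by simp [h])) fun k => e.step k (by simp [h])

/-! ### The lower bound -/

/-- The matrix is written only in status `record`, which is entered only by performing; the second
claim thus feeds the third in one induction. The lemma lets the last state of an execution testify
about its history. -/
theorem Execution.occurs_of_state (e : Execution (algorithm n m β)) (k : ℕ)
    (hk : (k : ℕ∞) ≤ e.len) :
    (∀ p, ((e.state k).loc p).status = .stopped → e.Occurs (.crash p)) ∧
    (∀ p, ((e.state k).loc p).status = .record →
      e.Occurs (.perform p ((e.state k).loc p).nxt)) ∧
    ∀ p i, 0 < (e.state k).done p i → e.Occurs (.perform p ((e.state k).done p i)) := by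
  induction k with
  | zero =>
    have : e.state 0 = initState n m := e.start_mem
    simp [this, initState]
  | succ k ih =>
    have hlt : (k : ℕ∞) < e.len := lt_of_lt_of_le (by exact_mod_cast Nat.lt_succ_self k) hk
    obtain ⟨h1, h2, h3⟩ := ih hlt.le
    have hs : trans n m β (e.state k) (e.act k) (e.state (k + 1)) := e.step k hlt
    have hocc : e.Occurs (e.act k) := ⟨k, hlt, rfl⟩
    generalize e.act k = a at hs hocc
    generalize e.state (k + 1) = s' at hs
    generalize e.state k = s at *
    by_cases hrec : ∃ p, a = .record p
    · obtain ⟨r, rfl⟩ := hrec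
      obtain ⟨hst, rfl⟩ := hs
      refine ⟨fun p => ?_, fun p => ?_, fun p i => ?_⟩
      · rcases eq_or_ne p r with rfl | hp
        · simp [State.setLoc, LocalState.record]
        · simpa [State.setLoc, hp] using h1 p
      · rcases eq_or_ne p r with rfl | hp
        · simp [State.setLoc, LocalState.record]
        · simpa [State.setLoc, hp] using h2 p
      · rcases eq_or_ne p r with rfl | hp
        · rcases eq_or_ne i ((s.loc p).pos p) with rfl | hi
          · simpa using fun _ => h2 p hst
          · simpa [hi] using h3 p i
        · simpa [hp] using h3 p i
    · have hdone : s'.done = s.done := by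
        cases a
        case record p => exact absurd ⟨p, rfl⟩ hrec
        case perform p j => obtain ⟨_, _, rfl⟩ := hs; rfl
        all_goals obtain ⟨_, rfl⟩ := hs; rfl
      rw [hdone]
      refine ⟨fun p => ?_, fun p => ?_, h3⟩ <;> by_cases hp : p = a.actor
      · cases a <;> simp only [Action.actor] at hp <;> subst hp
        case crash => exact fun _ => hocc
        case compNext =>
          obtain ⟨_, rfl⟩ := hs
          simp only [State.setLoc, Function.update_self, LocalState.compNext]
          split_ifs <;> simp
        case gatherTry =>
          obtain ⟨hst, rfl⟩ := hs
          simp only [State.setLoc, Function.update_self, LocalState.gatherTry_eq]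
          rcases LocalState.advance_spec ((s.loc p).readTry n s.next p) .gatherDone with h | h <;>
            simp [h.2.1, LocalState.readTry_status, hst]
        case gatherDone =>
          obtain ⟨hst, rfl⟩ := hs
          simp only [State.setLoc, Function.update_self, LocalState.gatherDone]
          split_ifs
          · simp [hst]
          · rcases LocalState.advance_spec (s.loc p) .check with h | h <;> simp [h.2.1, hst]
        case check =>
          obtain ⟨_, rfl⟩ := hs
          simp only [State.setLoc, Function.update_self, LocalState.check]
          split_ifs <;> simp
        case perform => obtain ⟨_, _, rfl⟩ := hs; simp [State.setLoc]
        case record => exact absurd ⟨p, rfl⟩ hrec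
        all_goals obtain ⟨_, rfl⟩ := hs; simp [State.setLoc]
      · rw [(trans_of_actor_ne hs hp).1]; exact h1 p
      · cases a <;> simp only [Action.actor] at hp <;> subst hp
        case compNext =>
          obtain ⟨_, rfl⟩ := hs
          simp only [State.setLoc, Function.update_self, LocalState.compNext]
          split_ifs <;> simp
        case gatherTry =>
          obtain ⟨hst, rfl⟩ := hs
          simp only [State.setLoc, Function.update_self, LocalState.gatherTry_eq]
          rcases LocalState.advance_spec ((s.loc p).readTry n s.next p) .gatherDone with h | h <;>
            simp [h.2.1, LocalState.readTry_status, hst]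
        case gatherDone =>
          obtain ⟨hst, rfl⟩ := hs
          simp only [State.setLoc, Function.update_self, LocalState.gatherDone]
          split_ifs
          · simp [hst]
          · rcases LocalState.advance_spec (s.loc p) .check with h | h <;> simp [h.2.1, hst]
        case check =>
          obtain ⟨_, rfl⟩ := hs
          simp only [State.setLoc, Function.update_self, LocalState.check]
          split_ifs <;> simp
        case perform j =>
          obtain ⟨_, rfl, rfl⟩ := hs
          simpa [State.setLoc] using hocc
        case record => exact absurd ⟨p, rfl⟩ hrec
        all_goals obtain ⟨_, rfl⟩ := hs; simp [State.setLoc]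
      · rw [(trans_of_actor_ne hs hp).1]; exact h2 p

theorem exists_enabled {s : State m} {p : Fin m} (h1 : (s.loc p).status ≠ .finished)
    (h2 : (s.loc p).status ≠ .stopped) :
    ∃ a, (algorithm n m β).isLocal a ∧ (algorithm n m β).Enabled s a := by
  cases h : (s.loc p).status with
  | compNext => exact ⟨.compNext p, by simp [algorithm], _, h, rfl⟩
  | setNext => exact ⟨.setNext p, by simp [algorithm], _, h, rfl⟩
  | gatherTry => exact ⟨.gatherTry p, by simp [algorithm], _, h, rfl⟩
  | gatherDone => exact ⟨.gatherDone p, by simp [algorithm], _, h, rfl⟩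
  | check => exact ⟨.check p, by simp [algorithm], _, h, rfl⟩
  | perform => exact ⟨.perform p _, by simp [algorithm], _, h, rfl, rfl⟩
  | record => exact ⟨.record p, by simp [algorithm], _, h, rfl⟩
  | finished => exact absurd h h1
  | stopped => exact absurd h h2

/-- A surviving process must have terminated, since otherwise a local action would be enabled. Its
FREE set has at most (β - 1) + (m - 1) elements, and the complement in `Finset.Icc 1 n` consists of
recorded, hence performed, jobs. -/
theorem le_numDone {f : ℕ} (hβ : m ≤ β) (hf : f < m) (e : Execution (algorithm n m β))
    (he : e ∈ fairExecs (algorithm n m β) f) : n ≤ numDone n e + (β + m - 2) := by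
  obtain ⟨⟨hfair, -⟩, hcr⟩ := he
  obtain ⟨r, hr⟩ := ENat.ne_top_iff_exists.1 (e.len_ne_top hβ)
  have hrle : (r : ℕ∞) ≤ e.len := hr.le
  obtain ⟨hstopped, -, hdone⟩ := e.occurs_of_state r hrle
  have hinv := e.inv hβ r hrle
  obtain ⟨p, hp⟩ : ∃ p, p ∉ crashed e := by
    by_contra hc
    push Not at hc
    rw [Set.eq_univ_of_forall hc, Set.ncard_univ, Nat.card_eq_fintype_card, Fintype.card_fin] at hcr
    omega
  have hfin : ((e.state r).loc p).status = .finished := by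
    by_contra hc
    obtain ⟨a, ha, hen⟩ := exists_enabled (n := n) (β := β) hc fun hst => hp (hstopped p hst)
    exact hfair r hr.symm a ha hen
  have hl := hinv.loc p
  set l := (e.state r).loc p with hldef
  have h1 := hl.of_finished hfin
  have h2 := hl.try_card
  have h3 := Finset.le_card_sdiff l.try_ l.free
  have h4 : (Finset.Icc 1 n ∩ l.done).card ≤ numDone n e := by
    rw [numDone, ← Set.ncard_coe_finset]
    refine Set.ncard_le_ncard ?_ ((Finset.finite_toSet (Finset.Icc 1 n)).subset fun j hj => hj.1)
    intro j hj
    obtain ⟨hj1, hj2⟩ := Finset.mem_inter.1 (Finset.mem_coe.1 hj)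
    obtain ⟨q, i, -, -, rfl⟩ := (hinv.mem_done p j).1 hj2
    exact ⟨hj1, q, hdone q i (Finset.mem_Icc.1 hj1).1⟩
  have h5 := Finset.card_sdiff_add_card_inter (Finset.Icc 1 n) l.done
  rw [← hl.free_eq, Nat.card_Icc] at h5
  omega

/-! ### Reachability by restricted actions -/

/-- One step that performs only jobs in `J` and crashes only processes in `C`. -/
def Move (n β : ℕ) (J : Finset ℕ) (C : Finset (Fin m)) (s s' : State m) : Prop :=
  ∃ a, trans n m β s a s' ∧ (∀ p j, a = .perform p j → j ∈ J) ∧ ∀ p, a = .crash p → p ∈ C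

/-- Finitely many steps that perform only jobs in `J` and crash only processes in `C`. -/
def Reach (n β : ℕ) (J : Finset ℕ) (C : Finset (Fin m)) : State m → State m → Prop :=
  Relation.ReflTransGen (Move n β J C)

variable {J : Finset ℕ} {C : Finset (Fin m)}

theorem Reach.refl (s : State m) : Reach n β J C s s := Relation.ReflTransGen.refl

theorem Reach.trans {s t u : State m} (h₁ : Reach n β J C s t) (h₂ : Reach n β J C t u) :
    Reach n β J C s u := Relation.ReflTransGen.trans h₁ h₂

theorem Reach.inv {s s' : State m} (h : Reach n β J C s s') (hβ : m ≤ β) (hs : Inv n β s) :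
    Inv n β s' := by
  induction h with
  | refl => exact hs
  | tail _ hm ih => obtain ⟨a, ha, -⟩ := hm; exact ih.step hβ ha

theorem Reach.of_trans {s s' : State m} {a : Action m} (h : KK.trans n m β s a s')
    (hp : ∀ p j, a ≠ .perform p j) (hc : ∀ p, a ≠ .crash p) : Reach n β J C s s' :=
  Relation.ReflTransGen.single
    ⟨a, h, fun p j e => absurd e (hp p j), fun p e => absurd e (hc p)⟩

theorem Reach.exists_execution {s : State m} (h : Reach n β J C (initState n m) s) (p : Fin m) :
    ∃ (e : Execution (algorithm n m β)) (r : ℕ), e.len = r ∧ e.state r = s ∧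
      (∀ p j, e.Occurs (.perform p j) → j ∈ J) ∧ ∀ p, e.Occurs (.crash p) → p ∈ C := by
  induction h with
  | refl =>
    -- The execution has length 0; the process `p` only supplies a filler for the irrelevant action
    -- sequence.
    refine ⟨⟨0, fun _ => initState n m, fun _ => .compNext p, rfl, by simp⟩, 0, rfl, rfl, ?_, ?_⟩
    · rintro p j ⟨k, hk, -⟩; simp at hk
    · rintro p ⟨k, hk, -⟩; simp at hk
  | @tail t u _ hm ih =>
    obtain ⟨e, r, hlen, hr, hJ, hC⟩ := ih
    obtain ⟨a, ha, haJ, haC⟩ := hm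
    have hold : ∀ b, (∃ k : ℕ, (k : ℕ∞) < ((r + 1 : ℕ) : ℕ∞) ∧
        (if k < r then e.act k else a) = b) → e.Occurs b ∨ b = a := by
      rintro b ⟨k, hk, hb⟩
      split_ifs at hb with hkr
      · exact Or.inl ⟨k, by rw [hlen]; exact_mod_cast hkr, hb⟩
      · exact Or.inr hb.symm
    refine ⟨⟨((r + 1 : ℕ) : ℕ∞), fun k => if k ≤ r then e.state k else u,
      fun k => if k < r then e.act k else a, by simpa using e.start_mem, ?_⟩, r + 1, rfl,
      by simp, ?_, ?_⟩
    · intro k hk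
      have hk : k < r + 1 := by exact_mod_cast hk
      rcases (Nat.lt_succ_iff.1 hk).lt_or_eq with hlt | rfl
      · have := e.step k (by rw [hlen]; exact_mod_cast hlt)
        simpa [hlt.le, hlt, Nat.succ_le_of_lt hlt] using this
      · simpa [hr, algorithm] using ha
    · intro p j hocc
      rcases hold _ hocc with h1 | h1
      · exact hJ p j h1
      · exact haJ p j h1.symm
    · intro p hocc
      rcases hold _ hocc with h1 | h1
      · exact hC p h1
      · exact haC p h1.symm

/-! ### Rules for replacing a local state -/

@[simp] theorem State.setLoc_loc_self (s : State m) (p : Fin m) (l : LocalState m) :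
    (s.setLoc p l).loc p = l := by simp [State.setLoc]

@[simp] theorem State.setLoc_loc_of_ne (s : State m) {p q : Fin m} (h : q ≠ p)
    (l : LocalState m) : (s.setLoc p l).loc q = s.loc q := by simp [State.setLoc, h]

@[simp] theorem State.setLoc_next (s : State m) (p : Fin m) (l : LocalState m) :
    (s.setLoc p l).next = s.next := rfl

@[simp] theorem State.setLoc_done (s : State m) (p : Fin m) (l : LocalState m) :
    (s.setLoc p l).done = s.done := rfl

@[simp] theorem State.setLoc_setLoc (s : State m) (p : Fin m) (l l' : LocalState m) :
    (s.setLoc p l).setLoc p l' = s.setLoc p l' := by simp [State.setLoc]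

theorem State.setLoc_loc (s : State m) (p : Fin m) : s.setLoc p (s.loc p) = s := by
  simp [State.setLoc]

/-! ### One process running alone -/

/-- Job `z` occurs in the shared matrix. -/
def State.Recorded (s : State m) (z : ℕ) : Prop := ∃ q i, s.done q i = z

/-- While `p` reads alone the array `next` is frozen, so TRY collects exactly a snapshot of the
cells from the loop index on. Keeping `s` fixed and varying only `l` allows induction on the
remaining cells. -/
theorem reach_gatherTry {s : State m} (hs : ∀ j, s.next j ≤ n) (p : Fin m) (l : LocalState m)
    (hl : l.status = .gatherTry) :
    ∃ l', Reach n β J C (s.setLoc p l) (s.setLoc p l') ∧ l'.status = .gatherDone ∧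
      l'.q.val = 0 ∧ l'.nxt = l.nxt ∧
      ∀ z, z ∈ l'.try_ ↔ z ∈ l.try_ ∨ ∃ j, l.q ≤ j ∧ j ≠ p ∧ z = s.next j := by
  induction hd : m - l.q.val using Nat.strong_induction_on generalizing l with
  | _ d ih =>
    have hstep : Reach n β J C (s.setLoc p l) (s.setLoc p (l.gatherTry n s.next p)) :=
      Reach.of_trans (a := .gatherTry p) ⟨by simpa using hl, by simp⟩ (by simp) (by simp)
    have h1 := (l.readTry n s.next p).advance_spec .gatherDone
    have htry : ∀ z, z ∈ (l.gatherTry n s.next p).try_ ↔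
        z ∈ l.try_ ∨ l.q ≠ p ∧ z = s.next l.q := by
      intro z
      rw [LocalState.gatherTry_eq, LocalState.advance_try, LocalState.mem_readTry _ _ _ hs]
    have hnxt : (l.gatherTry n s.next p).nxt = l.nxt := by
      rw [LocalState.gatherTry_eq, LocalState.advance_nxt, LocalState.readTry_eq]
    rw [← LocalState.gatherTry_eq, LocalState.readTry_q, LocalState.readTry_status] at h1
    have hq := l.q.2
    rcases h1 with ⟨h1, h2, h3⟩ | ⟨h1, h2, h3⟩
    · obtain ⟨l', h4, h5, h6, h7, h8⟩ := ih _ (by rw [h3]; omega) (l.gatherTry n s.next p)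
        (h2.trans hl) rfl
      refine ⟨l', hstep.trans h4, h5, h6, h7.trans hnxt, fun z => ?_⟩
      rw [h8, htry, or_assoc]
      refine or_congr Iff.rfl ⟨?_, ?_⟩
      · rintro (⟨h, hz⟩ | ⟨j, hj, hz⟩)
        · exact ⟨l.q, le_rfl, h, hz⟩
        · exact ⟨j, by rw [Fin.le_def] at hj ⊢; omega, hz⟩
      · rintro ⟨j, hj, hz⟩
        rcases hj.lt_or_eq with hj | rfl
        · exact Or.inr ⟨j, by rw [Fin.le_def, h3]; rw [Fin.lt_def] at hj; omega, hz⟩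
        · exact Or.inl hz
    · refine ⟨l.gatherTry n s.next p, hstep, h2, h3, hnxt, fun z => ?_⟩
      rw [htry]
      refine or_congr Iff.rfl ⟨fun h => ⟨l.q, le_rfl, h⟩, ?_⟩
      rintro ⟨j, hj, hz⟩
      have hj' := j.2
      have : j = l.q := by rw [Fin.le_def] at hj; ext; omega
      exact this ▸ hz

theorem reach_gatherDone (hβ : m ≤ β) {s : State m} (p : Fin m) (l : LocalState m)
    (hinv : Inv n β (s.setLoc p l)) (hl : l.status = .gatherDone)
    (hq : ∀ j < l.q, j ≠ p → l.pos j = (s.loc j).pos j) :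
    ∃ l', Reach n β J C (s.setLoc p l) (s.setLoc p l') ∧ l'.status = .check ∧
      l'.nxt = l.nxt ∧ l'.try_ = l.try_ ∧ ∀ j ≠ p, l'.pos j = (s.loc j).pos j := by
  -- Each step either consumes an unread column or passes to the next row.
  induction hd : ∑ j, (n + 1 - l.pos j) + (m - l.q.val) using Nat.strong_induction_on
    generalizing l with
  | _ d ih =>
    have hstep : Reach n β J C (s.setLoc p l) (s.setLoc p (l.gatherDone n s.done p)) :=
      Reach.of_trans (a := .gatherDone p) ⟨by simpa using hl, by simp⟩ (by simp) (by simp)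
    have hinv' := hstep.inv hβ hinv
    have hqm := l.q.2
    by_cases hif : l.q ≠ p ∧ l.pos l.q ≤ n ∧ 0 < s.done l.q (l.pos l.q)
    · have hlt : ∑ j, (n + 1 - (l.gatherDone n s.done p).pos j) < ∑ j, (n + 1 - l.pos j) := by
        simp only [LocalState.gatherDone, if_pos hif]
        refine Finset.sum_lt_sum (fun j _ => ?_) ⟨l.q, Finset.mem_univ _, ?_⟩
        · rcases eq_or_ne j l.q with rfl | hj
          · simp only [Function.update_self]; omega
          · simp [hj]
        · simp only [Function.update_self]; omega
      have hqe : (l.gatherDone n s.done p).q = l.q := by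
        simp only [LocalState.gatherDone, if_pos hif]
      obtain ⟨l', h1, h2, h3, h4, h5⟩ := ih _ (by rw [hqe, ← hd]; omega)
        (l.gatherDone n s.done p) hinv' (by simpa only [LocalState.gatherDone, if_pos hif] using hl)
        (by
          intro j hj hjp
          rw [hqe] at hj
          simpa [LocalState.gatherDone, if_pos hif, hj.ne] using hq j hj hjp) rfl
      refine ⟨l', hstep.trans h1, h2, ?_, ?_, h5⟩
      · rw [h3]; simp only [LocalState.gatherDone, if_pos hif]
      · rw [h4]; simp only [LocalState.gatherDone, if_pos hif]
    · have heq : l.gatherDone n s.done p = l.advance .check := by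
        simp only [LocalState.gatherDone, if_neg hif]
      rw [heq] at hstep hinv'
      have hle : ∀ j ≤ l.q, j ≠ p → l.pos j = (s.loc j).pos j := by
        intro j hj hjp
        rcases hj.lt_or_eq with hj | rfl
        · exact hq j hj hjp
        · have h1 := hinv.done_pos l.q (l.pos l.q)
          have h2 := hinv.pos_le_pos p l.q
          have h3 := (hinv.loc l.q).pos_le
          have h4 := hinv.one_le_pos p l.q
          simp only [State.setLoc_loc_self, State.setLoc_loc_of_ne _ hjp, State.setLoc_done] at *
          by_contra hne
          exact hif ⟨hjp, by omega, h1.2 ⟨h4, by omega⟩⟩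
      rcases l.advance_spec .check with ⟨h1, h2, h3⟩ | ⟨h1, h2, h3⟩
      · obtain ⟨l', h4, h5, h6, h7, h8⟩ := ih _
          (by rw [LocalState.advance_pos, h3, ← hd]; omega) (l.advance .check) hinv' (h2.trans hl)
          (by
            intro j hj hjp
            rw [LocalState.advance_pos]
            exact hle j (by rw [Fin.lt_def, h3] at hj; rw [Fin.le_def]; omega) hjp) rfl
        exact ⟨l', hstep.trans h4, h5, by rw [h6, LocalState.advance_nxt],
          by rw [h7, LocalState.advance_try], h8⟩
      · refine ⟨l.advance .check, hstep, h2, LocalState.advance_nxt _ _,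
          LocalState.advance_try _ _, fun j hjp => ?_⟩
        rw [LocalState.advance_pos]
        exact hle j (by have := j.2; rw [Fin.le_def]; omega) hjp

/-- A process that runs alone from `gatherTry` to `check` learns of all announced and all recorded
jobs. -/
theorem reach_check (hβ : m ≤ β) {s : State m} (hinv : Inv n β s) (p : Fin m)
    (hst : (s.loc p).status = .gatherTry) :
    ∃ l', Reach n β J C s (s.setLoc p l') ∧ l'.status = .check ∧ l'.nxt = (s.loc p).nxt ∧
      (∀ z, z ∈ l'.try_ ↔ z ∈ (s.loc p).try_ ∨
        ∃ j, (s.loc p).q ≤ j ∧ j ≠ p ∧ z = s.next j) ∧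
      (∀ z, z ∈ l'.done ↔ 0 < z ∧ s.Recorded z) ∧
      ∀ z, z ∈ l'.free ↔ z ∈ Finset.Icc 1 n ∧ ¬ s.Recorded z := by
  obtain ⟨l₁, h1, h2, h3, h4, h5⟩ :=
    reach_gatherTry (β := β) (J := J) (C := C) hinv.next_le p (s.loc p) hst
  rw [s.setLoc_loc] at h1
  have hinv₁ := h1.inv hβ hinv
  obtain ⟨l₂, k1, k2, k3, k4, k5⟩ := reach_gatherDone (J := J) (C := C) hβ p l₁ hinv₁ h2
    (fun j hj => by rw [Fin.lt_def, h3] at hj; omega)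
  have hinv₂ := k1.inv hβ hinv₁
  have hdone : ∀ z, z ∈ l₂.done ↔ 0 < z ∧ s.Recorded z := by
    intro z
    have hm := hinv₂.mem_done p z
    have hp := hinv₂.done_pos
    have hdiag : ∀ q, l₂.pos q = ((s.setLoc p l₂).loc q).pos q := by
      intro q
      rcases eq_or_ne q p with rfl | hq
      · simp
      · simpa [hq] using k5 q hq
    simp only [State.setLoc_loc_self, State.setLoc_done] at hm hp
    rw [hm]
    constructor
    · rintro ⟨q, i, h, h', rfl⟩
      exact ⟨(hp q i).2 ⟨h, by rwa [← hdiag]⟩, q, i, rfl⟩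
    · rintro ⟨hz, q, i, rfl⟩
      have := (hp q i).1 hz
      exact ⟨q, i, this.1, by rw [hdiag]; exact this.2, rfl⟩
  refine ⟨l₂, h1.trans k1, k2, k3.trans h4, by rw [k4]; exact h5, hdone, fun z => ?_⟩
  have hf := (hinv₂.loc p).free_eq
  rw [State.setLoc_loc_self] at hf
  rw [hf, Finset.mem_sdiff, hdone, Finset.mem_Icc]
  constructor
  · rintro ⟨h, h'⟩; exact ⟨h, fun hr => h' ⟨by omega, hr⟩⟩
  · rintro ⟨h, h'⟩; exact ⟨h, fun hr => h' hr.2⟩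

/-- A process that runs alone and finds its job announced by another process. -/
theorem reach_of_conflict (hβ : m ≤ β) {s : State m} (hinv : Inv n β s) (p : Fin m)
    (hst : (s.loc p).status = .gatherTry)
    (hc : (s.loc p).nxt ∈ (s.loc p).try_ ∨
      ∃ j, (s.loc p).q ≤ j ∧ j ≠ p ∧ (s.loc p).nxt = s.next j) :
    ∃ l', Reach n β J C s (s.setLoc p l') ∧ l'.status = .compNext ∧
      (∀ z, z ∈ l'.try_ ↔ z ∈ (s.loc p).try_ ∨
        ∃ j, (s.loc p).q ≤ j ∧ j ≠ p ∧ z = s.next j) ∧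
      ∀ z, z ∈ l'.free ↔ z ∈ Finset.Icc 1 n ∧ ¬ s.Recorded z := by
  obtain ⟨l, h1, h2, h3, h4, h5, h6⟩ := reach_check (J := J) (C := C) hβ hinv p hst
  refine ⟨{ l with status := .compNext }, h1.trans ?_, rfl, h4, h6⟩
  refine Reach.of_trans (a := .check p) ⟨by simpa using h2, ?_⟩ (by simp) (by simp)
  have : l.nxt ∈ l.try_ := by rw [h4, h3]; exact hc
  simp [LocalState.check, this]

/-- A process that runs alone and performs its job. -/
theorem reach_of_no_conflict (hβ : m ≤ β) {s : State m} (hinv : Inv n β s) (p : Fin m)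
    (hst : (s.loc p).status = .gatherTry) (hJ : (s.loc p).nxt ∈ J)
    (hc : ¬ ((s.loc p).nxt ∈ (s.loc p).try_ ∨
      ∃ j, (s.loc p).q ≤ j ∧ j ≠ p ∧ (s.loc p).nxt = s.next j))
    (hrec : ¬ s.Recorded (s.loc p).nxt) :
    ∃ s', Reach n β J C s s' ∧ (s'.loc p).status = .compNext ∧
      (∀ q ≠ p, s'.loc q = s.loc q) ∧ s'.next = s.next ∧
      (∀ z, z ∈ (s'.loc p).try_ ↔ z ∈ (s.loc p).try_ ∨
        ∃ j, (s.loc p).q ≤ j ∧ j ≠ p ∧ z = s.next j) ∧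
      (∀ z, 0 < z → (s'.Recorded z ↔ s.Recorded z ∨ z = (s.loc p).nxt)) ∧
      ∀ z, z ∈ (s'.loc p).free ↔ z ∈ Finset.Icc 1 n ∧ ¬ s'.Recorded z := by
  obtain ⟨l, h1, h2, h3, h4, h5, h6⟩ := reach_check (J := J) (C := C) hβ hinv p hst
  have ht : l.nxt ∉ l.try_ := by rw [h4, h3]; exact hc
  have hd : l.nxt ∉ l.done := by rw [h5, h3]; exact fun h => hrec h.2
  have k1 : Reach n β J C (s.setLoc p l) (s.setLoc p { l with status := .perform }) :=
    Reach.of_trans (a := .check p)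
      ⟨by simpa using h2, by simp [LocalState.check, ht, hd]⟩ (by simp) (by simp)
  have k2 : Reach n β J C (s.setLoc p { l with status := .perform })
      (s.setLoc p { l with status := .record }) := by
    refine Relation.ReflTransGen.single ⟨.perform p l.nxt, ⟨by simp, by simp, by simp⟩, ?_, ?_⟩
    · rintro p' j he
      injection he with _ he
      rw [← he, h3]; exact hJ
    · simp
  set t := s.setLoc p { l with status := .record } with ht'
  have htp : t.loc p = { l with status := .record } := by simp [ht']
  set s' : State m := { t.setLoc p ((t.loc p).record p) with
    done := Function.update t.done p (Function.update (t.done p) ((t.loc p).pos p) (t.loc p).nxt) }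
    with hs'
  have k3 : Reach n β J C t s' :=
    Reach.of_trans (a := .record p) ⟨by simp [htp], rfl⟩ (by simp) (by simp)
  have hreach := h1.trans (k1.trans (k2.trans k3))
  have hinvt := (h1.trans (k1.trans k2)).inv hβ hinv
  -- The cell about to be written is still empty, so no recorded job is overwritten.
  have hzero : s.done p (l.pos p) = 0 := by
    have := (hinvt.done_pos p (l.pos p)).not.2
    rw [htp] at this
    simpa [ht'] using this
  have hloc : s'.loc p = LocalState.record p { l with status := .record } := by
    rw [hs', htp]; simp
  -- For z = 0 being recorded only means that some cell is empty, whence the restriction to positive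
  -- z.
  have hR : ∀ z, 0 < z → (s'.Recorded z ↔ s.Recorded z ∨ z = (s.loc p).nxt) := by
    intro z hz
    simp only [hs', ht', State.setLoc_done, State.Recorded]
    constructor
    · rintro ⟨q, i, h⟩
      rcases eq_or_ne q p with rfl | hq
      · rcases eq_or_ne i (l.pos q) with rfl | hi
        · right; rw [← h3]; simpa using h.symm
        · exact Or.inl ⟨q, i, by simpa [hi] using h⟩
      · exact Or.inl ⟨q, i, by simpa [hq] using h⟩
    · rintro (⟨q, i, h⟩ | h)
      · refine ⟨q, i, ?_⟩
        rcases eq_or_ne q p with rfl | hq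
        · have hi : i ≠ l.pos q := by rintro rfl; omega
          simpa [hi] using h
        · simpa [hq] using h
      · exact ⟨p, l.pos p, by simp [h, h3]⟩
  refine ⟨s', hreach, by rw [hloc]; rfl, ?_, by simp [hs', ht'], by rw [hloc]; exact h4, hR, ?_⟩
  · intro q hq
    simp [hs', ht', hq]
  · intro z
    rw [hloc]
    simp only [LocalState.record, Finset.mem_erase, h6, Finset.mem_Icc, h3]
    constructor
    · rintro ⟨a, b, c⟩
      exact ⟨b, fun h => ((hR z (by omega)).1 h).elim c a⟩
    · rintro ⟨a, b⟩
      have := (hR z (by omega)).not.1 b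
      tauto

/-- Let the processes of a set run one after the other. -/
theorem reach_all {R : State m → Prop} {Good : Fin m → LocalState m → ℕ → Prop} (s₀ : State m)
    (hR : R s₀) (A : Finset (Fin m))
    (hone : ∀ q ∈ A, ∀ s, R s → s.loc q = s₀.loc q → s.next q = s₀.next q →
      ∃ s', Reach n β J C s s' ∧ R s' ∧
        (∀ j ≠ q, s'.loc j = s.loc j ∧ s'.next j = s.next j) ∧ Good q (s'.loc q) (s'.next q)) :
    ∃ s, Reach n β J C s₀ s ∧ R s ∧ (∀ q ∈ A, Good q (s.loc q) (s.next q)) ∧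
      ∀ q ∉ A, s.loc q = s₀.loc q ∧ s.next q = s₀.next q := by
  induction A using Finset.induction_on with
  | empty => exact ⟨s₀, Reach.refl _, hR, by simp, by simp⟩
  | insert a A ha ih =>
    obtain ⟨s, h1, h2, h3, h4⟩ := ih fun q hq => hone q (Finset.mem_insert_of_mem hq)
    obtain ⟨s', k1, k2, k3, k4⟩ := hone a (Finset.mem_insert_self _ _) s h2 (h4 a ha).1 (h4 a ha).2
    refine ⟨s', h1.trans k1, k2, ?_, ?_⟩
    · intro q hq
      rcases Finset.mem_insert.1 hq with rfl | hqA
      · exact k4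
      · have hqa : q ≠ a := by rintro rfl; exact ha hqA
        rw [(k3 q hqa).1, (k3 q hqa).2]
        exact h3 q hqA
    · intro q hq
      rw [Finset.mem_insert, not_or] at hq
      rw [(k3 q hq.1).1, (k3 q hq.1).2]
      exact h4 q hq.2

/-! ### The schedule of the adversary

Process `w` works. Every other process `q` selects the job `x q` at the very beginning. The ones
with `c < q` announce it and crash; the others announce it at the moment when `w` has announced
the same job, read `next w`, and pause until `w` terminates. -/

/-- The state when `w` has dealt with all jobs below `y`. -/
structure Stage (n β c : ℕ) (x : Fin m → ℕ) (w : Fin m) (y : ℕ) (s : State m) : Prop where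
  inv : Inv n β s
  worker : (s.loc w).status = .compNext
  free : ∀ z, z ∈ (s.loc w).free ↔ z ∈ Finset.Icc 1 n ∧ ¬ s.Recorded z
  recorded : ∀ z ∈ Finset.Icc 1 n, s.Recorded z ↔ z < y ∧ ∀ q ≠ w, z ≠ x q
  announced : ∀ q ≠ w, q.val ≤ c → x q < y → (s.loc q).status = .gatherTry ∧
    (s.loc q).q.val = 1 ∧ (s.loc q).try_ = {x q} ∧ (s.loc q).nxt = x q
  waiting : ∀ q ≠ w, q.val ≤ c → y ≤ x q → (s.loc q).status = .setNext ∧ (s.loc q).nxt = x q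
  stopped : ∀ q ≠ w, c < q.val → (s.loc q).status = .stopped
  next_eq : ∀ q ≠ w, x q < y ∨ c < q.val → s.next q = x q
  next_zero : ∀ q ≠ w, ¬ (x q < y ∨ c < q.val) → s.next q = 0
  -- Before its first cycle `w` knows none of the announcements of the crashed processes. Later, TRY
  -- may also contain 0, read from processes that have not announced yet.
  try_ : y = 1 ∧ (s.loc w).try_ = ∅ ∨
    ∀ z, 0 < z → (z ∈ (s.loc w).try_ ↔ ∃ q ≠ w, z = x q ∧ (x q < y ∨ c < q.val))

/-- The jobs from `y` on that are not announced by a crashed process. -/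
def remaining (n c : ℕ) (x : Fin m → ℕ) (y : ℕ) : Finset ℕ :=
  (Finset.Icc y n).filter fun z => ∀ q : Fin m, c < q.val → z ≠ x q

theorem elementOfRank_Icc {r : ℕ} (h1 : 1 ≤ r) (hn : r ≤ n) :
    elementOfRank (Finset.Icc 1 n) r = r := by
  refine elementOfRank_eq h1 (Finset.mem_Icc.2 ⟨h1, hn⟩) ?_
  have : (Finset.Icc 1 n).filter (· < r) = Finset.Icc 1 (r - 1) := by
    ext z; simp only [Finset.mem_filter, Finset.mem_Icc]; omega
  rw [below, this, Nat.card_Icc]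
  omega

theorem initState_loc_compNext (q : Fin m) (hn : β ≤ n) (hm : m ≤ n) :
    ((initState n m).loc q).compNext β q =
      { (initState n m).loc q with nxt := chosenRank m n q, status := .setNext } := by
  have hr : chosenRank m n q ≤ n := chosenRank_le q.2 hm (by omega)
  simp [LocalState.compNext, initState, hn, elementOfRank_Icc (one_le_chosenRank _ _ _) hr]

theorem exists_stage_one (hβ : m ≤ β) (hn : β ≤ n) {c : ℕ} {w : Fin m}
    (hC : ∀ q : Fin m, c < q.val → q ∈ C) :
    ∃ s, Reach n β J C (initState n m) s ∧
      Stage n β c (fun q => chosenRank m n q) w 1 s := by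
  have hm : m ≤ n := hβ.trans hn
  obtain ⟨s, h1, h2, h3, h4⟩ := reach_all (n := n) (β := β) (J := J) (C := C)
    (R := fun s => s.done = fun _ _ => 0)
    (Good := fun q l x =>
      (q.val ≤ c → l.status = .setNext ∧ l.nxt = chosenRank m n q ∧ x = 0) ∧
      (c < q.val → l.status = .stopped ∧ x = chosenRank m n q))
    (initState n m) rfl (Finset.univ.erase w) (by
      intro q _ s hR hloc hnext
      have hst : (s.loc q).status = .compNext := by rw [hloc]; rfl
      have k1 : Reach n β J C s (s.setLoc q ((s.loc q).compNext β q)) :=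
        Reach.of_trans (a := .compNext q) ⟨hst, rfl⟩ (by simp) (by simp)
      rw [hloc, initState_loc_compNext q hn hm] at k1
      by_cases hq : q.val ≤ c
      · exact ⟨_, k1, hR, fun j hj => by simp [hj],
          fun _ => ⟨by simp, by simp, by simpa [initState] using hnext⟩,
          fun h => absurd hq (by omega)⟩
      · set s₁ := s.setLoc q { (initState n m).loc q with
          nxt := chosenRank m n q, status := .setNext } with hs₁
        have k2 : Reach n β J C s₁ { s₁.setLoc q { s₁.loc q with status := .gatherTry } with
            next := Function.update s₁.next q (s₁.loc q).nxt } :=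
          Reach.of_trans (a := .setNext q) ⟨by simp [hs₁], rfl⟩ (by simp) (by simp)
        set s₂ : State m := { s₁.setLoc q { s₁.loc q with status := .gatherTry } with
            next := Function.update s₁.next q (s₁.loc q).nxt } with hs₂
        have hl₂ : (s₂.loc q).status = .gatherTry := by simp [hs₂, State.setLoc]
        have k3 : Reach n β J C s₂ (s₂.setLoc q { s₂.loc q with status := .stopped }) := by
          refine Relation.ReflTransGen.single ⟨.crash q, ⟨by simp [hl₂], rfl⟩, by simp, ?_⟩
          rintro p he
          injection he with he
          exact he ▸ hC q (by omega)
        refine ⟨_, k1.trans (k2.trans k3), hR, fun j hj => ?_, fun h => absurd h hq, fun _ => ?_⟩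
        · simp [hs₂, hs₁, State.setLoc, hj]
        · simp [hs₂, hs₁])
  refine ⟨s, h1, ?_⟩
  have hwl := (h4 w (by simp)).1
  have hrec : ∀ z, 0 < z → ¬ s.Recorded z := by
    rintro z hz ⟨q, i, h⟩
    simp [h2] at h
    omega
  have h3' : ∀ q ≠ w, _ := fun q hq => h3 q (by simpa using hq)
  refine ⟨h1.inv hβ inv_init, by rw [hwl]; rfl, fun z => ?_, fun z hz => ?_, fun q _ _ hq => ?_,
    fun q hq hc _ => ?_, fun q hq hc => ((h3' q hq).2 hc).1, fun q hq h => ?_, fun q hq h => ?_,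
    Or.inl ⟨rfl, by rw [hwl]; rfl⟩⟩
  · rw [hwl]
    simp only [initState, Finset.mem_Icc]
    exact ⟨fun h => ⟨h, hrec z (by omega)⟩, fun h => h.1⟩
  · rw [Finset.mem_Icc] at hz
    exact ⟨fun h => absurd h (hrec z (by omega)), fun h => absurd h.1 (by omega)⟩
  · have := one_le_chosenRank m n q
    omega
  · exact ⟨((h3' q hq).1 hc).1, ((h3' q hq).1 hc).2.1⟩
  · have := one_le_chosenRank m n q
    exact ((h3' q hq).2 (by omega)).2
  · push Not at h
    exact ((h3' q hq).1 h.2).2.2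

section

variable {c : ℕ} {x : Fin m → ℕ} {w : Fin m} {y : ℕ} {s : State m}

/-- No step is taken: the job of a crashed process is already in TRY, so `w` passes over it. The
condition `1 < y` excludes the initial stage, where TRY is still empty. -/
theorem Stage.skip (h : Stage n β c x w y s) (hx : Function.Injective x) (hy : 1 < y)
    {q₀ : Fin m} (hq₀ : q₀ ≠ w) (hc : c < q₀.val) (hyx : y = x q₀) :
    Stage n β c x w (y + 1) s := by
  have hlt : ∀ q : Fin m, q.val ≤ c → (x q < y + 1 ↔ x q < y) := by
    intro q hq
    have : x q ≠ y := fun e => by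
      have := hx (e.trans hyx)
      rw [this] at hq
      omega
    omega
  have hor : ∀ q : Fin m, (x q < y + 1 ∨ c < q.val) ↔ (x q < y ∨ c < q.val) := by
    intro q
    by_cases hq : q.val ≤ c
    · rw [hlt q hq]
    · simp [not_le.1 hq]
  refine ⟨h.inv, h.worker, h.free, fun z hz => ?_, fun q hq hqc hl => ?_, fun q hq hqc hl => ?_,
    h.stopped, fun q hq hl => h.next_eq q hq ((hor q).1 hl),
    fun q hq hl => h.next_zero q hq fun h' => hl ((hor q).2 h'), Or.inr ?_⟩
  · rw [h.recorded z hz]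
    refine and_congr_left fun hz' => ?_
    have := hz' q₀ hq₀
    omega
  · exact h.announced q hq hqc ((hlt q hqc).1 hl)
  · exact h.waiting q hq hqc (by omega)
  · rcases h.try_ with h' | h'
    · omega
    · simpa only [hor] using h'

/-- The first two steps of a cycle of `w`. -/
theorem Stage.reach_announce (h : Stage n β c x w y s) (hw : w.val = 0)
    (hyn : y ∈ Finset.Icc 1 n) (hyc : ∀ q : Fin m, c < q.val → y ≠ x q)
    (hcard : β ≤ (remaining n c x y).card) :
    ∃ s', Reach n β J C s s' ∧ (s'.loc w).status = .gatherTry ∧ (s'.loc w).q.val = 0 ∧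
      (s'.loc w).try_ = ∅ ∧ (s'.loc w).nxt = y ∧ s'.next w = y ∧ s'.done = s.done ∧
      ∀ q ≠ w, s'.loc q = s.loc q ∧ s'.next q = s.next q := by
  have hy := Finset.mem_Icc.1 hyn
  set l := s.loc w with hl
  have hsub : remaining n c x y ⊆ l.free \ l.try_ := by
    intro z hz
    obtain ⟨hz1, hz2⟩ := Finset.mem_filter.1 hz
    rw [Finset.mem_Icc] at hz1
    have hzn : z ∈ Finset.Icc 1 n := Finset.mem_Icc.2 (by omega)
    rw [Finset.mem_sdiff, h.free, h.recorded z hzn]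
    refine ⟨⟨hzn, fun h' => absurd h'.1 (by omega)⟩, ?_⟩
    rcases h.try_ with h' | h'
    · rw [h'.2]; simp
    · rw [h' z (by omega)]
      rintro ⟨q, -, rfl, h1 | h1⟩
      · omega
      · exact hz2 q h1 rfl
  -- A job below `y` is either recorded or some `x q` that has been announced and is in TRY; so `y`
  -- is the least candidate and rank 1 selects it.
  have hge : ∀ z ∈ l.free \ l.try_, y ≤ z := by
    intro z hz
    rw [Finset.mem_sdiff, h.free] at hz
    obtain ⟨⟨hz1, hz2⟩, hz3⟩ := hz
    rw [h.recorded z hz1] at hz2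
    rw [Finset.mem_Icc] at hz1
    by_contra hlt
    push Not at hlt
    have : ∃ q ≠ w, z = x q := by
      by_contra hne
      push Not at hne
      exact hz2 ⟨hlt, hne⟩
    obtain ⟨q, hq, rfl⟩ := this
    rcases h.try_ with h' | h'
    · omega
    · exact hz3 ((h' _ (by omega)).2 ⟨q, hq, rfl, Or.inl hlt⟩)
  have hymem : y ∈ l.free \ l.try_ :=
    hsub (Finset.mem_filter.2 ⟨Finset.mem_Icc.2 ⟨le_rfl, hy.2⟩, hyc⟩)
  have hnxt : elementOfRank (l.free \ l.try_) (chosenRank m l.free.card w) = y := by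
    rw [hw, chosenRank_zero]
    refine elementOfRank_eq le_rfl hymem ?_
    rw [below, Finset.filter_eq_empty_iff.2, Finset.card_empty]
    exact fun z hz => not_lt.2 (hge z hz)
  have hle : β ≤ (l.free \ l.try_).card := hcard.trans (Finset.card_le_card hsub)
  have k1 : Reach n β J C s (s.setLoc w (l.compNext β w)) :=
    Reach.of_trans (a := .compNext w) ⟨h.worker, rfl⟩ (by simp) (by simp)
  simp only [LocalState.compNext, if_pos hle, hnxt] at k1
  set s₁ := s.setLoc w _ with hs₁
  have k2 : Reach n β J C s₁ { s₁.setLoc w { s₁.loc w with status := .gatherTry } with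
      next := Function.update s₁.next w (s₁.loc w).nxt } :=
    Reach.of_trans (a := .setNext w) ⟨by simp [hs₁], rfl⟩ (by simp) (by simp)
  refine ⟨_, k1.trans k2, ?_, ?_, ?_, ?_, ?_, ?_, ?_⟩
  all_goals simp [State.setLoc, hs₁]
  intro q hq
  simp [hq]

theorem State.Recorded.congr {s s' : State m} (h : s'.done = s.done) (z : ℕ) :
    s'.Recorded z ↔ s.Recorded z := by
  rw [State.Recorded, State.Recorded, h]

/-- All other cells of `next` contain 0 or some `x q` different from `y`, so the check of `w`
succeeds. -/
theorem Stage.perform (h : Stage n β c x w y s) (hw : w.val = 0) (hm : m ≤ β)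
    (hyn : y ∈ Finset.Icc 1 n) (hyx : ∀ q ≠ w, y ≠ x q) (hcw : ∀ q : Fin m, c < q.val → q ≠ w)
    (hcard : β ≤ (remaining n c x y).card) (hJ : y ∈ J) :
    ∃ s', Reach n β J C s s' ∧ Stage n β c x w (y + 1) s' := by
  have hy := Finset.mem_Icc.1 hyn
  obtain ⟨s₁, k1, a1, a2, a3, a4, a5, a6, a7⟩ :=
    h.reach_announce (J := J) (C := C) hw hyn (fun q hq => hyx q (hcw q hq)) hcard
  have hinv₁ := k1.inv hm h.inv
  have hq0 : ∀ j, (s₁.loc w).q ≤ j := fun j => by rw [Fin.le_def]; omega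
  have hnext : ∀ q ≠ w, s₁.next q = if x q < y ∨ c < q.val then x q else 0 := by
    intro q hq
    rw [(a7 q hq).2]
    split_ifs with hif
    · exact h.next_eq q hq hif
    · exact h.next_zero q hq hif
  have hlt : ∀ q ≠ w, (x q < y + 1 ↔ x q < y) := by
    intro q hq
    have := hyx q hq
    omega
  obtain ⟨s₂, k2, b1, b2, b3, b4, b5, b6⟩ :=
    reach_of_no_conflict (J := J) (C := C) hm hinv₁ w a1 (by rwa [a4]) (by
      rw [a3, a4]
      rintro (h' | ⟨j, -, hj, h'⟩)
      · simp at h'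
      · rw [hnext j hj] at h'
        split_ifs at h'
        · exact hyx j hj h'
        · omega) (by
      rw [a4, State.Recorded.congr a6, h.recorded y hyn]
      exact fun h' => lt_irrefl _ h'.1)
  refine ⟨s₂, k1.trans k2, ⟨(k1.trans k2).inv hm h.inv, b1, b6, fun z hz => ?_,
    fun q hq hqc hl => ?_, fun q hq hqc hl => ?_, fun q hq hqc => ?_, fun q hq hl => ?_,
    fun q hq hl => ?_, Or.inr fun z hz => ?_⟩⟩
  · rw [b5 z (by rw [Finset.mem_Icc] at hz; omega), State.Recorded.congr a6, h.recorded z hz, a4]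
    constructor
    · rintro (⟨h1, h2⟩ | rfl)
      · exact ⟨by omega, h2⟩
      · exact ⟨by omega, hyx⟩
    · rintro ⟨h1, h2⟩
      rcases (Nat.lt_succ_iff.1 h1).lt_or_eq with h3 | h3
      · exact Or.inl ⟨h3, h2⟩
      · exact Or.inr h3
  · rw [b2 q hq, (a7 q hq).1]
    exact h.announced q hq hqc ((hlt q hq).1 hl)
  · rw [b2 q hq, (a7 q hq).1]
    exact h.waiting q hq hqc (by omega)
  · rw [b2 q hq, (a7 q hq).1]
    exact h.stopped q hq hqc
  · rw [hlt q hq] at hl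
    rw [b3, hnext q hq, if_pos hl]
  · rw [hlt q hq] at hl
    rw [b3, hnext q hq, if_neg hl]
  · rw [b4, a3]
    constructor
    · rintro (h' | ⟨j, -, hj, h'⟩)
      · simp at h'
      · rw [hnext j hj] at h'
        split_ifs at h' with hif
        · exact ⟨j, hj, h', by rwa [hlt j hj]⟩
        · omega
    · rintro ⟨q, hq, rfl, hif⟩
      rw [hlt q hq] at hif
      exact Or.inr ⟨q, hq0 q, hq, by rw [hnext q hq, if_pos hif]⟩

/-- Both processes announce `y` before either reads the other's cell, so each sees the conflict. As
`w` has index 0, a single read puts `y` into the TRY of `r`. Then `r` pauses, and its announcement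
keeps `w` away from `y` for good. -/
theorem Stage.collide (h : Stage n β c x w y s) (hx : Function.Injective x) (hw : w.val = 0)
    (hm : m ≤ β) (hyn : y ∈ Finset.Icc 1 n) {r : Fin m} (hr : r ≠ w)
    (hrc : r.val ≤ c) (hyr : y = x r) (hcard : β ≤ (remaining n c x y).card) :
    ∃ s', Reach n β J C s s' ∧ Stage n β c x w (y + 1) s' := by
  have hy := Finset.mem_Icc.1 hyn
  have hxne : ∀ q ≠ r, x q ≠ y := fun q hq e => hq (hx (e.trans hyr))
  obtain ⟨s₁, k1, a1, a2, a3, a4, a5, a6, a7⟩ :=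
    h.reach_announce (J := J) (C := C) hw hyn
      (fun q hq => (hxne q (by rintro rfl; omega)).symm) hcard
  have hinv₁ := k1.inv hm h.inv
  have hrw : r.val ≠ 0 := fun e => hr (Fin.ext (e.trans hw.symm))
  have hlr : (s₁.loc r).status = .setNext ∧ (s₁.loc r).nxt = x r := by
    rw [(a7 r hr).1]
    exact h.waiting r hr hrc hyr.le
  obtain ⟨hr1, hr2⟩ := (hinv₁.loc r).of_setNext hlr.1
  have k2 : Reach n β J C s₁ { s₁.setLoc r { s₁.loc r with status := .gatherTry } with
      next := Function.update s₁.next r (s₁.loc r).nxt } :=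
    Reach.of_trans (a := .setNext r) ⟨hlr.1, rfl⟩ (by simp) (by simp)
  set s₂ : State m := { s₁.setLoc r { s₁.loc r with status := .gatherTry } with
      next := Function.update s₁.next r (s₁.loc r).nxt } with hs₂
  have hl₂ : s₂.loc r = { s₁.loc r with status := .gatherTry } := by simp [hs₂, State.setLoc]
  have hinv₂ := (k1.trans k2).inv hm h.inv
  have hqw : (s₂.loc r).q = w := by rw [hl₂]; exact Fin.ext (hr2.trans hw.symm)
  have hnw : s₂.next w = y := by simp [hs₂, Ne.symm hr, a5]
  have k3 : Reach n β J C s₂ (s₂.setLoc r ((s₂.loc r).gatherTry n s₂.next r)) :=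
    Reach.of_trans (a := .gatherTry r) ⟨by rw [hl₂], rfl⟩ (by simp) (by simp)
  set l₃ := (s₂.loc r).gatherTry n s₂.next r with hl₃
  have hl₃' : l₃.status = .gatherTry ∧ l₃.q.val = 1 ∧ l₃.try_ = {x r} ∧ l₃.nxt = x r := by
    have hsp := ((s₂.loc r).readTry n s₂.next r).advance_spec .gatherDone
    rw [← LocalState.gatherTry_eq, ← hl₃, LocalState.readTry_q, LocalState.readTry_status,
      hqw, hw] at hsp
    have hrm := r.2
    rcases hsp with ⟨h1, h2, h3⟩ | ⟨h1, -⟩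
    · refine ⟨by rw [h2, hl₂], h3, ?_, ?_⟩
      · ext z
        rw [hl₃, LocalState.gatherTry_eq, LocalState.advance_try,
          LocalState.mem_readTry _ _ _ hinv₂.next_le, hqw, hl₂, hr1, hnw, hyr]
        simp [Ne.symm hr]
      · rw [hl₃, LocalState.gatherTry_eq, LocalState.advance_nxt, LocalState.readTry_eq, hl₂]
        exact hlr.2
    · omega
  set s₃ := s₂.setLoc r l₃ with hs₃
  have k123 := k1.trans (k2.trans k3)
  have hinv₃ := k123.inv hm h.inv
  have hlw : s₃.loc w = s₁.loc w := by simp [hs₃, hs₂, State.setLoc, Ne.symm hr]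
  have hdone₃ : s₃.done = s.done := a6
  have hloc₃ : ∀ q ≠ w, q ≠ r → s₃.loc q = s.loc q := by
    intro q hq hqr
    rw [← (a7 q hq).1]
    simp [hs₃, hs₂, State.setLoc, hqr]
  have hnext₃ : ∀ q ≠ w, s₃.next q = if x q < y + 1 ∨ c < q.val then x q else 0 := by
    intro q hq
    rcases eq_or_ne q r with rfl | hqr
    · rw [if_pos (Or.inl (by omega))]
      simp [hs₃, hs₂, hlr.2]
    · have hlt : x q < y + 1 ↔ x q < y := by
        have := hxne q hqr
        omega
      have : s₃.next q = s.next q := by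
        rw [← (a7 q hq).2]
        simp [hs₃, hs₂, hqr]
      simp only [this, hlt]
      split_ifs with hif
      · exact h.next_eq q hq hif
      · exact h.next_zero q hq hif
  have hq0 : ∀ j, (s₃.loc w).q ≤ j := fun j => by rw [hlw, Fin.le_def]; omega
  obtain ⟨l, k4, b1, b2, b3⟩ := reach_of_conflict (J := J) (C := C) hm hinv₃ w (by rwa [hlw])
    (Or.inr ⟨r, hq0 r, hr, by rw [hlw, a4, hnext₃ r hr, if_pos (Or.inl (by omega)), hyr]⟩)
  refine ⟨_, k123.trans k4, ⟨(k123.trans k4).inv hm h.inv, by simpa using b1,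
    fun z => by rw [State.setLoc_loc_self, b3]; exact Iff.rfl,
    fun z hz => ?_, fun q hq hqc hl => ?_, fun q hq hqc hl => ?_, fun q hq hqc => ?_,
    fun q hq hl => ?_, fun q hq hl => ?_, Or.inr fun z hz => ?_⟩⟩
  · rw [State.Recorded.congr (s := s) (s' := s₃.setLoc w l) hdone₃, h.recorded z hz]
    refine and_congr_left fun hz' => ?_
    have := hz' r hr
    omega
  · rw [State.setLoc_loc_of_ne _ hq]
    rcases eq_or_ne q r with rfl | hqr
    · rw [hs₃, State.setLoc_loc_self]
      exact hl₃'
    · rw [hloc₃ q hq hqr]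
      have := hxne q hqr
      exact h.announced q hq hqc (by omega)
  · rw [State.setLoc_loc_of_ne _ hq, hloc₃ q hq (by rintro rfl; omega)]
    exact h.waiting q hq hqc (by omega)
  · rw [State.setLoc_loc_of_ne _ hq, hloc₃ q hq (by rintro rfl; omega)]
    exact h.stopped q hq hqc
  · rw [State.setLoc_next, hnext₃ q hq, if_pos hl]
  · rw [State.setLoc_next, hnext₃ q hq, if_neg hl]
  · rw [State.setLoc_loc_self, b2, hlw, a3]
    constructor
    · rintro (h' | ⟨j, -, hj, h'⟩)
      · simp at h'
      · rw [hnext₃ j hj] at h'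
        split_ifs at h' with hif
        · exact ⟨j, hj, h', hif⟩
        · omega
    · rintro ⟨q, hq, rfl, hif⟩
      exact Or.inr ⟨q, hlw ▸ hq0 q, hq, by rw [hnext₃ q hq, if_pos hif]⟩

/-- When `w` is left with fewer than `β` jobs, all processes terminate. -/
theorem Stage.reach_final (h : Stage n β c x w y s) (hw : w.val = 0) (hm : m ≤ β) (hy1 : 1 < y)
    (hcw : ∀ q : Fin m, c < q.val → q ≠ w)
    (hann : ∀ q ≠ w, q.val ≤ c → x q < y) (hcard : (remaining n c x y).card < β) :
    ∃ s', Reach n β J C s s' ∧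
      ∀ q, (s'.loc q).status = .finished ∨ (s'.loc q).status = .stopped := by
  -- A process that knows the matrix and all jobs `x q` has only candidates from `remaining n c x
  -- y`, too few to continue.
  have hsmall : ∀ F T : Finset ℕ, (∀ z, z ∈ F ↔ z ∈ Finset.Icc 1 n ∧ ¬ s.Recorded z) →
      (∀ z, 0 < z → (z ∈ T ↔ ∃ q ≠ w, z = x q)) → (F \ T).card < β := by
    intro F T hF hT
    refine (Finset.card_le_card ?_).trans_lt hcard
    intro z hz
    rw [Finset.mem_sdiff, hF] at hz
    obtain ⟨⟨hz1, hz2⟩, hz3⟩ := hz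
    rw [h.recorded z hz1] at hz2
    rw [Finset.mem_Icc] at hz1
    rw [hT z (by omega)] at hz3
    push Not at hz3
    refine Finset.mem_filter.2 ⟨Finset.mem_Icc.2 ⟨?_, hz1.2⟩, fun q hq => hz3 q (hcw q hq)⟩
    by_contra hlt
    exact hz2 ⟨by omega, hz3⟩
  have hor : ∀ q ≠ w, x q < y ∨ c < q.val := fun q hq => by
    rcases le_or_gt q.val c with h' | h'
    · exact Or.inl (hann q hq h')
    · exact Or.inr h'
  have k1 : Reach n β J C s (s.setLoc w ((s.loc w).compNext β w)) :=
    Reach.of_trans (a := .compNext w) ⟨h.worker, rfl⟩ (by simp) (by simp)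
  have hlt := hsmall (s.loc w).free (s.loc w).try_ h.free (by
    intro z hz
    rcases h.try_ with h' | h'
    · omega
    · rw [h' z hz]
      exact ⟨fun ⟨q, hq, hz', _⟩ => ⟨q, hq, hz'⟩, fun ⟨q, hq, hz'⟩ => ⟨q, hq, hz', hor q hq⟩⟩)
  simp only [LocalState.compNext, if_neg (not_le.2 hlt)] at k1
  set s₁ := s.setLoc w _ with hs₁
  have hinv₁ := k1.inv hm h.inv
  obtain ⟨s₂, k2, -, b1, b2⟩ := reach_all (n := n) (β := β) (J := J) (C := C)
    (R := fun t => Inv n β t ∧ t.next = s.next ∧ t.done = s.done)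
    (Good := fun _ l _ => l.status = .finished) s₁ ⟨hinv₁, rfl, rfl⟩
    (Finset.univ.filter fun q => q ≠ w ∧ q.val ≤ c) (by
      rintro q hq t ⟨hinv, hnext, hdone⟩ hloc -
      obtain ⟨hqw, hqc⟩ := (Finset.mem_filter.1 hq).2
      rw [hs₁, State.setLoc_loc_of_ne _ hqw] at hloc
      obtain ⟨c1, c2, c3, c4⟩ := h.announced q hqw hqc (hann q hqw hqc)
      rw [← hloc] at c1 c2 c3 c4
      obtain ⟨l, d1, d2, d3, d4⟩ := reach_of_conflict (J := J) (C := C) hm hinv q c1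
        (Or.inl (by rw [c3, c4]; simp))
      have d5 : Reach n β J C (t.setLoc q l) (t.setLoc q (l.compNext β q)) :=
        Reach.of_trans (a := .compNext q) ⟨by simpa using d2, by simp⟩ (by simp) (by simp)
      have hlt := hsmall l.free l.try_
        -- The resumed process reads the cells from index 1 on; with its own job, already in TRY,
        -- this yields exactly the jobs `x j` for j ≠ w.
        (fun z => by rw [d4, State.Recorded.congr hdone]) (fun z hz => by
          rw [d3, c3, Finset.mem_singleton, hnext]
          constructor
          · rintro (rfl | ⟨j, hj, hjq, rfl⟩)
            · exact ⟨q, hqw, rfl⟩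
            · rw [Fin.le_def, c2] at hj
              have hjw : j ≠ w := by rintro rfl; omega
              exact ⟨j, hjw, h.next_eq j hjw (hor j hjw)⟩
          · rintro ⟨j, hjw, rfl⟩
            rcases eq_or_ne j q with rfl | hjq
            · exact Or.inl rfl
            · refine Or.inr ⟨j, ?_, hjq, (h.next_eq j hjw (hor j hjw)).symm⟩
              rw [Fin.le_def, c2]
              have : j.val ≠ 0 := fun e => hjw (Fin.ext (e.trans hw.symm))
              omega)
      refine ⟨_, d1.trans d5, ⟨(d1.trans d5).inv hm hinv, hnext, hdone⟩, fun j hj => by simp [hj],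
        ?_⟩
      simp [LocalState.compNext, if_neg (not_le.2 hlt)])
  refine ⟨s₂, k1.trans k2, fun q => ?_⟩
  by_cases hq : q ≠ w ∧ q.val ≤ c
  · exact Or.inl (b1 q (by simpa using hq))
  · rw [(b2 q (by simpa using hq)).1]
    rcases eq_or_ne q w with rfl | hqw
    · left; simp [hs₁]
    · right
      rw [hs₁, State.setLoc_loc_of_ne _ hqw]
      exact h.stopped q hqw (by by_contra hc; exact hq ⟨hqw, by omega⟩)

end

/-! ### Counting -/

theorem remaining_antitone {c : ℕ} {x : Fin m → ℕ} {y y' : ℕ} (h : y ≤ y') :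
    remaining n c x y' ⊆ remaining n c x y :=
  Finset.filter_subset_filter _ (Finset.Icc_subset_Icc_left h)

theorem card_remaining_le_succ (c : ℕ) (x : Fin m → ℕ) (y : ℕ) :
    (remaining n c x y).card ≤ (remaining n c x (y + 1)).card + 1 := by
  refine (Finset.card_le_card (t := insert y (remaining n c x (y + 1))) ?_).trans
    (Finset.card_insert_le _ _)
  intro z hz
  simp only [remaining, Finset.mem_insert, Finset.mem_filter, Finset.mem_Icc] at hz ⊢
  rcases hz.1.1.lt_or_eq with h | h
  · exact Or.inr ⟨⟨h, hz.1.2⟩, hz.2⟩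
  · exact Or.inl h.symm

theorem card_fin_gt {f : ℕ} (hf : f < m) :
    (Finset.univ.filter fun q : Fin m => m - 1 - f < q.val).card = f := by
  have h : (Finset.univ.filter fun q : Fin m => m - 1 - f < q.val) =
      Finset.Ioi (⟨m - 1 - f, by omega⟩ : Fin m) := by
    ext q; simp [Fin.lt_def]
  rw [h, Fin.card_Ioi]
  simp only
  omega

/-- Only the f processes of index above m - 1 - f block jobs in `remaining`, each at most one. -/
theorem le_card_remaining {f : ℕ} (hf : f < m) (x : Fin m → ℕ) (y : ℕ) :
    n + 1 ≤ (remaining n (m - 1 - f) x y).card + y + f := by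
  set K := (Finset.univ.filter fun q : Fin m => m - 1 - f < q.val).image x with hK
  have h1 : K.card ≤ f := by
    have := Finset.card_image_le (s := Finset.univ.filter fun q : Fin m => m - 1 - f < q.val)
      (f := x)
    rwa [card_fin_gt hf] at this
  have h2 : Finset.Icc y n \ K ⊆ remaining n (m - 1 - f) x y := by
    intro z hz
    obtain ⟨hz1, hz2⟩ := Finset.mem_sdiff.1 hz
    refine Finset.mem_filter.2 ⟨hz1, fun q hq he => hz2 ?_⟩
    exact Finset.mem_image.2 ⟨q, by simpa using hq, he.symm⟩
  have h3 := Finset.card_le_card h2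
  have h4 := Finset.le_card_sdiff K (Finset.Icc y n)
  rw [Nat.card_Icc] at h4
  omega

/-- For t ≥ 1 and k = ⌊q * t⌋, failure means k ≥ n + 1 - f - β, while k * m ≤ q * (n - m + 1) ≤ (m -
f - 1) * (n - m + 1). Combining these contradicts `hlt` exactly. For t < 1 the rank is q + 1 and
`hn` suffices. -/
theorem chosenRank_add_le {f q : ℕ} (hm : m ≤ n) (hβ : m ≤ β) (hn : β + m - 1 ≤ n)
    (hlt : m * (β - m + f) < (f + 1) * (n - m + 1)) (hq : q + f + 1 ≤ m) :
    chosenRank m n q + f + β ≤ n + 1 := by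
  have hm0 : (0 : ℚ) < m := by exact_mod_cast (show 0 < m by omega)
  simp only [chosenRank]
  split_ifs with ht
  · set t : ℚ := ((n : ℚ) - ((m : ℚ) - 1)) / m with htdef
    have htm : t * m = n - (m - 1) := by rw [htdef]; field_simp
    set k := ⌊(q : ℚ) * t⌋₊ with hk
    have hkt : (k : ℚ) ≤ q * t := Nat.floor_le (by positivity)
    by_contra hc
    have hc' : n + 1 ≤ k + f + β := by omega
    have hc' : (n : ℚ) + 1 ≤ k + f + β := by exact_mod_cast hc'
    have hq' : (q : ℚ) + f + 1 ≤ m := by exact_mod_cast hq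
    have hlt' : (m : ℚ) * (β - m + f) < (f + 1) * (n - m + 1) := by
      have h : ((m * (β - m + f) : ℕ) : ℚ) < (((f + 1) * (n - m + 1) : ℕ) : ℚ) := by
        exact_mod_cast hlt
      push_cast [Nat.cast_sub hβ, Nat.cast_sub hm] at h
      exact h
    have h1 : (k : ℚ) * m ≤ q * (n - m + 1) := by
      calc (k : ℚ) * m ≤ q * t * m := by gcongr
        _ = q * (n - m + 1) := by rw [mul_assoc, htm]; ring
    have hN : (0 : ℚ) ≤ n - m + 1 := by
      have : (m : ℚ) ≤ n := by exact_mod_cast hm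
      linarith
    have h2 : (q : ℚ) * (n - m + 1) ≤ (m - f - 1) * (n - m + 1) :=
      mul_le_mul_of_nonneg_right (by linarith) hN
    have h3 : ((n : ℚ) + 1 - f - β) * m ≤ k * m :=
      mul_le_mul_of_nonneg_right (by linarith) hm0.le
    nlinarith
  · omega

/-! ### The upper bound -/

theorem exists_fair_numDone_le {f : ℕ} (hnm : m ≤ n) (hβ : m ≤ β) (hf : f < m)
    (hn : β + m - 1 ≤ n) (hlt : m * (β - m + f) < (f + 1) * (n - m + 1)) :
    ∃ e ∈ fairExecs (algorithm n m β) f, numDone n e ≤ n - (β + m - 2) := by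
  set w : Fin m := ⟨0, by omega⟩ with hw
  set c := m - 1 - f with hc
  set x : Fin m → ℕ := fun q => chosenRank m n q with hx
  set B := fun y => remaining n c x y with hB
  have hxmono : StrictMono x := fun p q h => chosenRank_strictMono m n h
  have hxw : x w = 1 := chosenRank_zero m n
  have hx1 : ∀ q, 1 ≤ x q := fun q => one_le_chosenRank _ _ _
  have hx2 : ∀ q ≠ w, 2 ≤ x q := by
    intro q hq
    have : x w < x q := hxmono (Fin.lt_def.2 (Nat.pos_of_ne_zero fun e => hq (Fin.ext e)))
    omega
  have hxn : ∀ q, x q ≤ n := fun q => chosenRank_le q.2 hnm (by omega)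
  have hcw : ∀ q : Fin m, c < q.val → q ≠ w := by
    rintro q hq rfl
    simp [hw] at hq
  have hex : ∃ y, (B y).card < β := by
    refine ⟨n + 1, ?_⟩
    have : B (n + 1) = ∅ := by simp [hB, remaining]
    rw [this, Finset.card_empty]
    omega
  -- `Y` is the point where `w` stops: the first place from which fewer than β unblocked jobs are
  -- left.
  set Y := Nat.find hex with hY
  have hYlt : (B Y).card < β := Nat.find_spec hex
  have hYmin : ∀ y < Y, β ≤ (B y).card := fun y hy => not_lt.1 (Nat.find_min hex hy)
  have hle : ∀ y, y + f + β ≤ n + 1 → y < Y := by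
    intro y hy
    by_contra hlt'
    have h1 := Finset.card_le_card (remaining_antitone (n := n) (c := c) (x := x)
      (not_lt.1 hlt'))
    have h2 : n + 1 ≤ (remaining n c x y).card + y + f := le_card_remaining hf x y
    have h3 : (remaining n c x Y).card < β := hYlt
    omega
  have hY1 : 1 < Y := hle 1 (by omega)
  -- This is where the second inequality enters: each live process has its collision with `w` before
  -- `w` stops.
  have hann : ∀ q ≠ w, q.val ≤ c → x q < Y := fun q _ hqc =>
    hle _ (chosenRank_add_le hnm hβ hn hlt (by omega))
  set J := (Finset.Icc 1 n).filter fun z => z < Y ∧ ∀ q ≠ w, z ≠ x q with hJ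
  set C := Finset.univ.filter fun q : Fin m => c < q.val with hC
  have hstage : ∀ y, 1 ≤ y → y ≤ Y → ∃ s, Reach n β J C (initState n m) s ∧
      Stage n β c x w y s := by
    intro y hy
    induction y, hy using Nat.le_induction with
    | base => exact fun _ => exists_stage_one hβ (by omega) (by simp [hC])
    | succ y hy ih =>
      intro hyY
      obtain ⟨s, h1, h2⟩ := ih (by omega)
      have hcard := hYmin y (by omega)
      have hyn : y ∈ Finset.Icc 1 n := by
        obtain ⟨z, hz⟩ := Finset.card_pos.1 (show 0 < (B y).card by omega)
        have := Finset.mem_Icc.1 (Finset.mem_filter.1 hz).1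
        exact Finset.mem_Icc.2 (by omega)
      by_cases hyx : ∃ q ≠ w, y = x q
      · obtain ⟨q, hq, hyq⟩ := hyx
        by_cases hqc : q.val ≤ c
        · obtain ⟨s', k1, k2⟩ := h2.collide (J := J) (C := C) hxmono.injective rfl hβ hyn
            hq hqc hyq hcard
          exact ⟨s', h1.trans k1, k2⟩
        · have := hx2 q hq
          exact ⟨s, h1, h2.skip hxmono.injective (by omega) hq (by omega) hyq⟩
      · push Not at hyx
        obtain ⟨s', k1, k2⟩ := h2.perform (J := J) (C := C) rfl hβ hyn hyx hcw hcard
          (Finset.mem_filter.2 ⟨hyn, by omega, hyx⟩)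
        exact ⟨s', h1.trans k1, k2⟩
  obtain ⟨s, h1, h2⟩ := hstage Y hY1.le le_rfl
  obtain ⟨s', k1, k2⟩ := h2.reach_final (J := J) (C := C) rfl hβ hY1 hcw hann hYlt
  obtain ⟨e, r, e1, e2, e3, e4⟩ := (h1.trans k1).exists_execution w
  refine ⟨e, ⟨⟨fun r' hr' a ha hen => ?_, fun htop => ?_⟩, ?_⟩, ?_⟩
  · have hrr : r' = r := by rw [e1] at hr'; exact_mod_cast hr'.symm
    rw [hrr, e2] at hen
    obtain ⟨t, ht⟩ := hen
    have hs := k2 a.actor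
    cases a with
    | crash p => exact ha p rfl
    | _ =>
      simp only [Action.actor] at hs
      have hst := ht.1
      rw [hst] at hs
      simp at hs
  · rw [e1] at htop
    exact absurd htop (ENat.natCast_ne_top r)
  · have : crashed e ⊆ (C : Set (Fin m)) := fun p hp => e4 p hp
    calc (crashed e).ncard ≤ (C : Set (Fin m)).ncard := Set.ncard_le_ncard this (Set.toFinite _)
      _ = f := by rw [Set.ncard_coe_finset]; exact card_fin_gt hf
  · have hsub : {j : ℕ | j ∈ Finset.Icc 1 n ∧ ∃ p, e.Occurs (.perform p j)} ⊆ (J : Set ℕ) := by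
      rintro j ⟨-, p, hp⟩
      exact e3 p j hp
    have hcardJ : numDone n e ≤ J.card := by
      rw [numDone, ← Set.ncard_coe_finset]
      exact Set.ncard_le_ncard hsub (Finset.finite_toSet J)
    set X := (Finset.univ.erase w).image x with hX
    have hXcard : X.card = m - 1 := by
      rw [hX, Finset.card_image_of_injective _ hxmono.injective,
        Finset.card_erase_of_mem (Finset.mem_univ _), Finset.card_fin]
    -- By minimality of `Y` at least β jobs remain at Y - 1, and one step loses at most one of them.
    -- Then `J`, `B Y` and `X` are disjoint in `Finset.Icc 1 n`, and the last two take up at least β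
    -- + m - 2 jobs.
    have hBY : β ≤ (B Y).card + 1 := by
      have h3 := hYmin (Y - 1) (by omega)
      have h4 := card_remaining_le_succ (n := n) c x (Y - 1)
      rw [show Y - 1 + 1 = Y by omega] at h4
      exact h3.trans h4
    have hdisjBX : Disjoint (B Y) X := by
      rw [Finset.disjoint_left]
      intro z hz hzX
      obtain ⟨q, hq, rfl⟩ := Finset.mem_image.1 hzX
      obtain ⟨hz1, hz2⟩ := Finset.mem_filter.1 hz
      have hq := (Finset.mem_erase.1 hq).1
      rcases le_or_gt q.val c with h' | h'
      · have := hann q hq h'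
        have := (Finset.mem_Icc.1 hz1).1
        omega
      · exact hz2 q h' rfl
    have hdisj : Disjoint J (B Y ∪ X) := by
      rw [Finset.disjoint_left]
      intro z hz hzU
      obtain ⟨-, hz1, hz2⟩ := Finset.mem_filter.1 hz
      rcases Finset.mem_union.1 hzU with h' | h'
      · have := (Finset.mem_Icc.1 (Finset.mem_filter.1 h').1).1
        omega
      · obtain ⟨q, hq, rfl⟩ := Finset.mem_image.1 h'
        exact hz2 q (Finset.mem_erase.1 hq).1 rfl
    have hun : J ∪ (B Y ∪ X) ⊆ Finset.Icc 1 n := by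
      intro z hz
      rcases Finset.mem_union.1 hz with h' | h'
      · exact (Finset.mem_filter.1 h').1
      · rcases Finset.mem_union.1 h' with h' | h'
        · have := Finset.mem_Icc.1 (Finset.mem_filter.1 h').1
          exact Finset.mem_Icc.2 (by omega)
        · obtain ⟨q, -, rfl⟩ := Finset.mem_image.1 h'
          exact Finset.mem_Icc.2 ⟨hx1 q, hxn q⟩
    have hcard := Finset.card_le_card hun
    rw [Finset.card_union_of_disjoint hdisj, Finset.card_union_of_disjoint hdisjBX, hXcard,
      Nat.card_Icc] at hcard
    omega

/-! ### Effectiveness -/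

theorem hasEffectiveness {f : ℕ} (hnm : m ≤ n) (hβ : m ≤ β) (hf : f < m)
    (hn : β + m - 1 ≤ n) (hlt : m * (β - m + f) < (f + 1) * (n - m + 1)) :
    HasEffectiveness (algorithm n m β) n f (n - (β + m - 2)) := by
  constructor
  · obtain ⟨e, he, hle⟩ := exists_fair_numDone_le hnm hβ hf hn hlt
    have := le_numDone hβ hf e he
    exact ⟨e, he, by omega⟩
  · rintro _ ⟨e, he, rfl⟩
    have := le_numDone hβ hf e he
    omega

end KK

theorem theorem2 (n m β f : ℕ) (hnm : m ≤ n) (hβ : m ≤ β) (hf : f < m) :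
    (∀ e ∈ KK.fairExecs (KK.algorithm n m β) f,
      e.len ≠ ⊤ ∧ n ≤ KK.numDone n e + (β + m - 2)) ∧
    (β + m - 1 ≤ n → m * (β - m + f) < (f + 1) * (n - m + 1) →
      KK.HasEffectiveness (KK.algorithm n m β) n f (n - (β + m - 2))) ∧
    (β = m → 2 * m - 1 ≤ n →
      KK.HasEffectiveness (KK.algorithm n m β) n f (n - (2 * m - 2))) := by
  refine ⟨fun e he => ⟨e.len_ne_top hβ, KK.le_numDone hβ hf e he⟩,
    KK.hasEffectiveness hnm hβ hf, ?_⟩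
  rintro rfl hn
  rw [two_mul]
  refine KK.hasEffectiveness hnm hβ hf (by omega) ?_
  rw [Nat.sub_self, zero_add]
  -- With the two parameters equal, `hn` gives n - β + 1 ≥ β, so the second inequality holds for
  -- every f.
  calc β * f < β * (f + 1) := Nat.mul_lt_mul_of_pos_left (Nat.lt_succ_self f) (by omega)
    _ = (f + 1) * β := Nat.mul_comm _ _
    _ ≤ (f + 1) * (n - β + 1) := Nat.mul_le_mul_left _ (by omega)
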